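/- Identify the Hardy spaces with spaces of boundary values: $H^2(\mathbb D)\subseteq L^2(\mathbb T)$ and $H^2(\mathbb D^n)\subseteq L^2(\mathbb T^n)$ are the closed linear spans of the monomials $z^k$ ($k\ge 0$), respectively $z_1^{k_1}\cdots z_n^{k_n}$ ($k_1,\dots,k_n\ge 0$), with respect to normalized Haar measure. For an essentially bounded symbol $\varphi$, the Toeplitz operator $T_\varphi$ is $h\mapsto P(\varphi h)$, where $P$ is the orthogonal projection of $L^2$ onto the Hardy space. For a commuting tuple $T=(T_1,\dots,T_n)$ of bounded operators on a Hilbert space $H$, let $H_p(T)$, $0\le p\le n$, be the homology of its Koszul complex $H\otimes\bigwedge^p\mathbb C^n$ with boundary $$\xi\, e_{i_1}\wedge\cdots\wedge e_{i_p}\mapsto\sum_{k=1}^p(-1)^{k-1}(T_{i_k}\xi)\,e_{i_1}\wedge\cdots\wedge\widehat{e_{i_k}}\wedge\cdots\wedge e_{i_p},\qquad i_1<\cdots<i_p,$$ so that $H_0(T)=H/(T_1H+\cdots+T_nH)$ and $H_n(T)=\bigcap_i\ker T_i$. A tuple of bounded operators is called Fredholm if its entries commute and all $H_p(T)$ are finite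 dimensional, and then $$\operatorname{Ind}T=\sum_{p=0}^n(-1)^{p+1}\dim H_p(T);$$ for $n=1$ this is $\dim\ker T-\dim\operatorname{coker}T$. **Proposition.** Let $n\ge 1$ and $f_1,\dots,f_n\in L^\infty(\mathbb T)$. For each $i$ let $T^{(i)}_{f_i}$ be the Toeplitz operator with symbol $f_i$ on the Hardy space $H^2(\mathbb D)$ in the variable $z_i$, and let $T_{f_i}$ be the Toeplitz operator on $H^2(\mathbb D^n)$ with symbol $(z_1,\dots,z_n)\mapsto f_i(z_i)$. Assume that none of the operators $T^{(i)}_{f_i}$ is invertible. Then the tuple $(T_{f_1},\dots,T_{f_n})$ is Fredholm if and only if every $T^{(i)}_{f_i}$ is Fredholm. In that case $$\operatorname{Ind}(T_{f_1},\dots,T_{f_n})=(-1)^{n+1}\prod_{i=1}^n\operatorname{Ind}T^{(i)}_{f_i}.$$ -/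

import Mathlib

open MeasureTheory AddCircle
open scoped ENNReal

noncomputable section

namespace FredholmTuple

/-! ### The Koszul complex of a tuple of operators

The Koszul complex `K_n → ⋯ → K_1 → K_0` of `T = (T_0, …, T_{n-1})` on `H`. A chain of degree `p` is
a sum `∑ ξ_S e_S` over the subsets `S` of `Fin n` with `p` elements, where
`e_S = e_{i_1} ∧ ⋯ ∧ e_{i_p}` for `S = {i_1 < ⋯ < i_p}`; it is stored as the family `(ξ_S)_S`. -/

section Koszul

variable {H : Type*} [NormedAddCommGroup H] [NormedSpace ℂ H] {n : ℕ}

/-- The chains of degree `p`: families of vectors supported on the subsets of cardinality `p`. -/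
def koszulChains (H : Type*) [NormedAddCommGroup H] [NormedSpace ℂ H] (n p : ℕ) :
    Submodule ℂ (Finset (Fin n) → H) where
  carrier := {ξ | ∀ S : Finset (Fin n), S.card ≠ p → ξ S = 0}
  zero_mem' := fun _ _ => rfl
  add_mem' := fun hξ hη S hS => by simp [hξ S hS, hη S hS]
  smul_mem' := fun c ξ hξ S hS => by simp [hξ S hS]

/-- The Koszul boundary, determined by
`ξ e_{i_1} ∧ ⋯ ∧ e_{i_p} ↦ ∑_k (-1)^{k-1} (T_{i_k} ξ) e_{i_1} ∧ ⋯ ∧ ê_{i_k} ∧ ⋯ ∧ e_{i_p}`.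
The coefficient of `e_S` in the image of `ξ` is therefore
`∑_{i ∉ S} (-1)^{#{j ∈ S : j < i}} T_i ξ_{S ∪ {i}}`. -/
def koszulBoundary (T : Fin n → H →L[ℂ] H) :
    (Finset (Fin n) → H) →ₗ[ℂ] (Finset (Fin n) → H) :=
  LinearMap.pi fun S => ∑ i ∈ Sᶜ,
    (-1 : ℂ) ^ (S.filter (fun j => j < i)).card •
      ((T i : H →ₗ[ℂ] H) ∘ₗ LinearMap.proj (insert i S))

/-- The cycles of degree `p`; in degree `0` the boundary vanishes and every chain is a cycle. -/
def koszulCycles (T : Fin n → H →L[ℂ] H) (p : ℕ) : Submodule ℂ (Finset (Fin n) → H) :=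
  koszulChains H n p ⊓ LinearMap.ker (koszulBoundary T)

/-- The boundaries of degree `p`: the image of the chains of degree `p + 1`. -/
def koszulBoundaries (T : Fin n → H →L[ℂ] H) (p : ℕ) : Submodule ℂ (Finset (Fin n) → H) :=
  (koszulChains H n (p + 1)).map (koszulBoundary T)

/-- The Koszul homology in degree `p`, cycles modulo boundaries. In degree `0` it is
`H ⧸ (T_0 H + ⋯ + T_{n-1} H)`, in degree `n` it is `⋂ ker T_i`. -/
abbrev KoszulHomology (T : Fin n → H →L[ℂ] H) (p : ℕ) : Type _ :=
  koszulCycles T p ⧸ (koszulBoundaries T p).submoduleOf (koszulCycles T p)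

/-- A tuple of bounded operators is Fredholm if its entries commute and all homology spaces of its
Koszul complex are finite dimensional. -/
structure IsFredholmTuple (T : Fin n → H →L[ℂ] H) : Prop where
  commute : ∀ i j, Commute (T i) (T j)
  finite_homology : ∀ p, p ≤ n → FiniteDimensional ℂ (KoszulHomology T p)

/-- The index `∑_{p = 0}^{n} (-1)^{p+1} dim H_p` of a Fredholm tuple. For one operator this is
`dim ker T - dim coker T`; for a pair it is `-dim H_0 + dim H_1 - dim H_2`. -/
def tupleIndex (T : Fin n → H →L[ℂ] H) : ℤ :=
  ∑ p ∈ Finset.range (n + 1), (-1 : ℤ) ^ (p + 1) * (Module.finrank ℂ (KoszulHomology T p) : ℤ)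

/-- The index `dim ker T - dim coker T` of a single Fredholm operator. -/
def fredholmIndex (T : H →L[ℂ] H) : ℤ :=
  (Module.finrank ℂ (LinearMap.ker (T : H →ₗ[ℂ] H)) : ℤ) -
    (Module.finrank ℂ (H ⧸ LinearMap.range (T : H →ₗ[ℂ] H)) : ℤ)

end Koszul

/-! ### Hardy spaces and Toeplitz operators -/

/-- Normalized Haar measure on the torus `𝕋ⁿ`, with `𝕋` modelled as `ℝ / ℤ` through
`t ↦ exp (2 π i t)`. -/
abbrev torusMeasure (n : ℕ) : Measure (UnitAddTorus (Fin n)) :=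
  Measure.pi fun _ => (haarAddCircle : Measure UnitAddCircle)

/-- The Hardy space of the unit disk, as the space of boundary values: the closed span in `L²(𝕋)`
of the monomials `z ^ k` with `k ≥ 0`. -/
def hardyDisk : Submodule ℂ (Lp ℂ 2 (haarAddCircle : Measure UnitAddCircle)) :=
  (Submodule.span ℂ ((fun k : ℤ => fourierLp (T := (1 : ℝ)) 2 k) '' {k | 0 ≤ k})).topologicalClosure

/-- The Hardy space of the polydisk `𝔻ⁿ`, as the space of boundary values: the closed span in
`L²(𝕋ⁿ)` of the monomials `z_1 ^ k_1 ⋯ z_n ^ k_n` with all `k_i ≥ 0`. -/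
def hardyPolydisk (n : ℕ) : Submodule ℂ (Lp ℂ 2 (torusMeasure n)) :=
  (Submodule.span ℂ
    ((fun k : Fin n → ℤ =>
        ContinuousMap.toLp (E := ℂ) 2 (torusMeasure n) ℂ (UnitAddTorus.mFourier k)) ''
      {k | ∀ i, 0 ≤ k i})).topologicalClosure

instance : CompleteSpace hardyDisk := Submodule.topologicalClosure.completeSpace _

instance (n : ℕ) : CompleteSpace (hardyPolydisk n) := Submodule.topologicalClosure.completeSpace _

/-- Multiplication by `φ ∈ L^∞`, compressed to a closed subspace `M` of `L²`: the operator
`h ↦ P_M (φ h)` on `M`. -/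
def compressedMul {X : Type*} [MeasurableSpace X] {μ : Measure X} (M : Submodule ℂ (Lp ℂ 2 μ))
    [M.HasOrthogonalProjection] (φ : Lp ℂ ∞ μ) : M →L[ℂ] M :=
  M.orthogonalProjectionOnto ∘L (ContinuousLinearMap.mul ℂ ℂ).holderL μ ∞ 2 2 φ ∘L M.subtypeL

/-- The one-variable Toeplitz operator on the Hardy space of the disk. -/
def toeplitzDisk (f : Lp ℂ ∞ (haarAddCircle : Measure UnitAddCircle)) :
    hardyDisk →L[ℂ] hardyDisk :=
  compressedMul hardyDisk f

/-- The Toeplitz operator on the Hardy space of the polydisk. -/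
def toeplitzPolydisk {n : ℕ} (φ : Lp ℂ ∞ (torusMeasure n)) :
    hardyPolydisk n →L[ℂ] hardyPolydisk n :=
  compressedMul (hardyPolydisk n) φ

/-- The function `(z_1, …, z_n) ↦ f (z_i)` on `𝕋ⁿ` for `f ∈ L^∞(𝕋)`. -/
def symbolInVariable {n : ℕ} (i : Fin n) (f : Lp ℂ ∞ (haarAddCircle : Measure UnitAddCircle)) :
    Lp ℂ ∞ (torusMeasure n) :=
  Lp.compMeasurePreserving (fun x : UnitAddTorus (Fin n) => x i)
    (measurePreserving_eval (fun _ => (haarAddCircle : Measure UnitAddCircle)) i) f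

end FredholmTuple

end

open FredholmTuple

/-!
The Hardy space `H²(𝔻ⁿ)` is the Hilbert space tensor product of `n` copies of `H²(𝔻)`, the pure
tensors being the products `g_1(z_1) ⋯ g_n(z_n)`, and the Toeplitz operator with symbol `f_i(z_i)`
is `T^{(i)}_{f_i}` acting on the `i`-th factor (`isHilbertTensor_hardyTensor`,
`toeplitzPolydisk_eq_lift`). The result then holds for the lifts `A_i` to a Hilbert tensor product
of arbitrary bounded operators on the factors; nothing else about Toeplitz operators is needed.

If all `A_i` are Fredholm, choose relative inverses `B_i`. Exterior multiplication by `e_i` combined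
with `B_i` is a homotopy on the Koszul complex between the identity and the diagonal operator acting
by `1 - B_i A_i` on the components `e_S` with `i ∈ S` and by `1 - A_i B_i` on the others
(`koszulBoundary_homotopy`). Composing over all `i`, the homology in degree `p` becomes the sum over
`|S| = p` of the ranges of products of projections (`IsRelativeInverse.homologyEquiv`), that is, of
the tensor products of the kernels of the factors in `S` with the cokernels of the other ones.
Their dimensions multiply (`IsHilbertTensor.finrank_range`), and the alternating sum is the expanded
product of the indices. To have the `B_i` act on the tensor product, it is written as a Hilbert sum
of copies of the `i`-th factor (`IsHilbertTensor.exists_lift`).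

Conversely, let the tuple be Fredholm. The Koszul boundary then has closed range, and a compactness
argument shows that, for each `S`, no orthonormal sequence is asymptotically annihilated by the
entries with `i ∈ S` and by the adjoints of the entries with `i ∉ S`
(`IsFredholmTuple.not_orthonormal`). If some operator were not Fredholm, it or its adjoint
would have an orthonormal sequence of approximate null vectors; each of the other ones, being
non-invertible, has approximate null unit vectors for itself or for its adjoint, and the tensors of
all these vectors would form a forbidden sequence (`IsHilbertTensor.isFredholm_of_isFredholmTuple`).
-/

namespace FredholmTuple

/-! ### The Koszul boundary and its homotopies -/

section KoszulAlgebra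

variable {H : Type*} [NormedAddCommGroup H] [NormedSpace ℂ H] {n : ℕ}

theorem koszulBoundary_apply (T : Fin n → H →L[ℂ] H) (ξ : Finset (Fin n) → H)
    (S : Finset (Fin n)) :
    koszulBoundary T ξ S =
      ∑ i ∈ Sᶜ, (-1 : ℂ) ^ (S.filter (fun j => j < i)).card • T i (ξ (insert i S)) := by
  simp [koszulBoundary, LinearMap.sum_apply]

theorem koszulSign_insert {S : Finset (Fin n)} {i : Fin n} (hi : i ∉ S) (k : Fin n) :
    (-1 : ℂ) ^ ((insert i S).filter (fun j => j < k)).card =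
      (if i < k then -1 else 1) * (-1 : ℂ) ^ (S.filter (fun j => j < k)).card := by
  rw [Finset.filter_insert]
  split_ifs
  · rw [Finset.card_insert_of_notMem (by simp [hi]), pow_succ, mul_comm]
  · rw [one_mul]

theorem koszulSign_mul_self (S : Finset (Fin n)) (i : Fin n) :
    (-1 : ℂ) ^ (S.filter (fun j => j < i)).card * (-1 : ℂ) ^ (S.filter (fun j => j < i)).card
      = 1 := by
  rw [← mul_pow]; simp

theorem koszulBoundary_mem_chains (T : Fin n → H →L[ℂ] H) {p : ℕ} {ξ : Finset (Fin n) → H}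
    (hξ : ξ ∈ koszulChains H n (p + 1)) : koszulBoundary T ξ ∈ koszulChains H n p := by
  intro S hS
  rw [koszulBoundary_apply]
  refine Finset.sum_eq_zero fun i hi => ?_
  rw [hξ (insert i S) (by rw [Finset.card_insert_of_notMem (Finset.mem_compl.1 hi)]; omega)]
  simp

/-- The boundary squares to zero: in each component the double sum over the two added indices is
antisymmetric. -/
theorem koszulBoundary_comp_self {T : Fin n → H →L[ℂ] H} (hT : ∀ i j, Commute (T i) (T j))
    (ξ : Finset (Fin n) → H) : koszulBoundary T (koszulBoundary T ξ) = 0 := by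
  funext S
  -- `F i k` is the contribution in which `i` is added first and `k` second.
  let F : Fin n → Fin n → H := fun i k =>
    if i ∉ S ∧ k ∉ S ∧ i ≠ k then
      ((-1 : ℂ) ^ (S.filter (fun j => j < i)).card *
        (-1 : ℂ) ^ ((insert i S).filter (fun j => j < k)).card) •
          T i (T k (ξ (insert k (insert i S))))
    else 0
  have hF : koszulBoundary T (koszulBoundary T ξ) S = ∑ i, ∑ k, F i k := by
    rw [koszulBoundary_apply, ← Finset.sum_subset (Finset.subset_univ Sᶜ)]
    · refine Finset.sum_congr rfl fun i hi => ?_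
      rw [koszulBoundary_apply, map_sum, Finset.smul_sum,
        ← Finset.sum_subset (Finset.subset_univ (insert i S)ᶜ)]
      · refine Finset.sum_congr rfl fun k hk => ?_
        simp only [Finset.mem_compl, Finset.mem_insert, not_or] at hi hk
        simp only [F]
        rw [if_pos ⟨hi, hk.2, Ne.symm hk.1⟩, map_smul, smul_smul]
      · intro k _ hk
        simp only [Finset.mem_compl, Finset.mem_insert, not_not] at hk
        simp only [F]
        rw [if_neg]
        rintro ⟨_, h2, h3⟩
        exact hk.elim (fun h => h3 h.symm) h2
    · intro i _ hi
      simp only [Finset.mem_compl, not_not] at hi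
      exact Finset.sum_eq_zero fun k _ => by simp [F, hi]
  have hanti : ∀ i k, F i k = - F k i := by
    intro i k
    simp only [F]
    by_cases h : i ∉ S ∧ k ∉ S ∧ i ≠ k
    · rw [if_pos h, if_pos ⟨h.2.1, h.1, h.2.2.symm⟩, koszulSign_insert h.1,
        koszulSign_insert h.2.1, Finset.insert_comm, ← neg_smul]
      have hc : T i (T k (ξ (insert i (insert k S)))) = T k (T i (ξ (insert i (insert k S)))) :=
        DFunLike.congr_fun (hT i k) _
      rw [hc]
      congr 1
      rcases lt_or_gt_of_ne h.2.2 with h' | h'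
      · rw [if_pos h', if_neg h'.not_gt]; ring
      · rw [if_pos h', if_neg h'.not_gt]; ring
    · rw [if_neg h, if_neg (fun h' => h ⟨h'.2.1, h'.1, h'.2.2.symm⟩), neg_zero]
  have hneg : ∑ i, ∑ k, F i k = -∑ i, ∑ k, F i k := by
    conv_lhs => rw [Finset.sum_comm]
    rw [← Finset.sum_neg_distrib]
    refine Finset.sum_congr rfl fun i _ => ?_
    rw [← Finset.sum_neg_distrib]
    exact Finset.sum_congr rfl fun k _ => hanti k i
  have htwo : (2 : ℂ) • ∑ i, ∑ k, F i k = 0 := by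
    rw [two_smul]
    exact add_eq_zero_iff_eq_neg.2 hneg
  rw [hF, Pi.zero_apply]
  exact (smul_eq_zero.1 htwo).resolve_left two_ne_zero

/-- The homotopy attached to the variable `i` and an operator `B`: exterior multiplication by
`e_i`, with `B` applied to the coefficients. -/
noncomputable def koszulHomotopy (B : H →L[ℂ] H) (i : Fin n) (ξ : Finset (Fin n) → H) :
    Finset (Fin n) → H := fun S =>
  if i ∈ S then (-1 : ℂ) ^ (S.filter (fun j => j < i)).card • B (ξ (S.erase i)) else 0

theorem koszulHomotopy_mem_chains (B : H →L[ℂ] H) (i : Fin n) {p : ℕ}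
    {ξ : Finset (Fin n) → H} (hξ : ξ ∈ koszulChains H n p) :
    koszulHomotopy B i ξ ∈ koszulChains H n (p + 1) := by
  intro S hS
  unfold koszulHomotopy
  split_ifs with h
  · have hpos := Finset.card_pos.2 ⟨i, h⟩
    rw [hξ (S.erase i) (by rw [Finset.card_erase_of_mem h]; omega)]
    simp
  · rfl

/-- If `B` commutes with all entries except possibly the `i`-th, the terms of `d h + h d` in which
an index other than `i` is removed cancel, and only a diagonal operator survives. -/
theorem koszulBoundary_homotopy (T : Fin n → H →L[ℂ] H) (B : H →L[ℂ] H) (i : Fin n)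
    (hB : ∀ k, k ≠ i → Commute (T k) B) (ξ : Finset (Fin n) → H) (S : Finset (Fin n)) :
    koszulBoundary T (koszulHomotopy B i ξ) S + koszulHomotopy B i (koszulBoundary T ξ) S =
      if i ∈ S then B (T i (ξ S)) else T i (B (ξ S)) := by
  by_cases hi : i ∈ S
  · obtain ⟨R, hR, rfl⟩ : ∃ R, i ∉ R ∧ insert i R = S :=
      ⟨S.erase i, Finset.notMem_erase i S, Finset.insert_erase hi⟩
    rw [if_pos hi, koszulBoundary_apply]
    unfold koszulHomotopy
    rw [if_pos hi, Finset.erase_insert hR, koszulBoundary_apply,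
      show Rᶜ = insert i (insert i R)ᶜ by
        ext x; by_cases hx : x = i <;> simp [hx, hR],
      Finset.sum_insert (by simp), map_add, smul_add, add_left_comm, map_smul, smul_smul,
      koszulSign_insert hR, if_neg (lt_irrefl i), one_mul, koszulSign_mul_self, one_smul,
      map_sum, Finset.smul_sum, ← Finset.sum_add_distrib, Finset.sum_eq_zero, add_zero]
    intro k hk
    simp only [Finset.mem_compl, Finset.mem_insert, not_or] at hk
    have hc : T k (B (ξ (insert k R))) = B (T k (ξ (insert k R))) :=
      DFunLike.congr_fun (hB k hk.1) _
    rw [if_pos (by simp), Finset.insert_comm k i R,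
      Finset.erase_insert (by simp [hR, Ne.symm hk.1]),
      koszulSign_insert (i := i) (S := insert k R) (by simp [hR, Ne.symm hk.1]),
      koszulSign_insert hk.2, koszulSign_insert hR, map_smul, map_smul, hc, smul_smul, smul_smul,
      ← add_smul, if_neg (lt_irrefl i)]
    rcases lt_or_gt_of_ne hk.1 with h' | h'
    · rw [if_pos h', if_neg h'.not_gt]; ring_nf; simp
    · rw [if_pos h', if_neg h'.not_gt]; ring_nf; simp
  · rw [if_neg hi, koszulBoundary_apply]
    unfold koszulHomotopy
    rw [if_neg hi, add_zero, Finset.sum_eq_single i]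
    · rw [if_pos (by simp), Finset.erase_insert hi, map_smul, smul_smul, koszulSign_insert hi,
        if_neg (lt_irrefl i), one_mul, koszulSign_mul_self, one_smul]
    · intro k _ hk
      rw [if_neg (by simp [hi, Ne.symm hk])]
      simp
    · intro h; exact absurd hi (by simpa using h)

end KoszulAlgebra

/-! ### Koszul homology of a tuple with relative inverses -/

section Kunneth

variable {H : Type*} [NormedAddCommGroup H] [NormedSpace ℂ H] {n : ℕ}

/-- The defect of a relative inverse `B` of `T`: `1 - B T`, a projection onto `ker T`, when `b` is
true, and `1 - T B`, a projection onto a complement of the range of `T`, when `b` is false. -/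
def defect (T B : H →L[ℂ] H) (b : Prop) [Decidable b] : H →L[ℂ] H :=
  if b then 1 - B * T else 1 - T * B

/-- The product of the defects of `(T_i, B_i)`, taken in the kernel for `i ∈ S` and in the cokernel
for `i ∉ S`. Its range is the contribution of `e_S` to the Koszul homology. -/
def defectProd (T B : Fin n → H →L[ℂ] H) (S : Finset (Fin n)) (l : List (Fin n)) : H →L[ℂ] H :=
  (l.map fun i => defect (T i) (B i) (i ∈ S)).prod

variable {T B : Fin n → H →L[ℂ] H}

theorem commute_defect {X T B : H →L[ℂ] H} (hT : Commute X T) (hB : Commute X B) (b : Prop)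
    [Decidable b] : Commute X (defect T B b) := by
  unfold defect
  split_ifs
  · exact (Commute.one_right X).sub_right (hB.mul_right hT)
  · exact (Commute.one_right X).sub_right (hT.mul_right hB)

theorem mul_defectProd_eq_zero {X : H →L[ℂ] H} {S : Finset (Fin n)} {i : Fin n}
    (hcomm : ∀ k, k ≠ i → Commute X (T k) ∧ Commute X (B k))
    (hzero : X * defect (T i) (B i) (i ∈ S) = 0) {l : List (Fin n)} (hi : i ∈ l) :
    X * defectProd T B S l = 0 := by
  induction l with
  | nil => simp at hi
  | cons j l ih =>
    simp only [defectProd, List.map_cons, List.prod_cons] at ih ⊢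
    by_cases hj : j = i
    · subst hj
      rw [← mul_assoc, hzero, zero_mul]
    · have hil : i ∈ l := (List.mem_cons.1 hi).resolve_left (fun h => hj h.symm)
      rw [← mul_assoc, (commute_defect (hcomm j hj).1 (hcomm j hj).2 _).eq, mul_assoc, ih hil,
        mul_zero]

theorem defectProd_mul_eq_zero {X : H →L[ℂ] H} {S : Finset (Fin n)} {i : Fin n}
    (hcomm : ∀ k, k ≠ i → Commute X (T k) ∧ Commute X (B k))
    (hzero : defect (T i) (B i) (i ∈ S) * X = 0) {l : List (Fin n)} (hi : i ∈ l) :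
    defectProd T B S l * X = 0 := by
  induction l with
  | nil => simp at hi
  | cons j l ih =>
    simp only [defectProd, List.map_cons, List.prod_cons] at ih ⊢
    by_cases hil : i ∈ l
    · rw [mul_assoc, ih hil, mul_zero]
    · obtain rfl : i = j := (List.mem_cons.1 hi).resolve_right hil
      have hc : Commute X (l.map fun i => defect (T i) (B i) (i ∈ S)).prod := by
        refine Commute.list_prod_right _ _ fun Y hY => ?_
        obtain ⟨k, hk, rfl⟩ := List.mem_map.1 hY
        have hki : k ≠ i := fun h => hil (h ▸ hk)
        exact commute_defect (hcomm k hki).1 (hcomm k hki).2 _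
      rw [mul_assoc, ← hc.eq, ← mul_assoc, hzero, zero_mul]

/-- Relative inverses `B_i` of the entries of a commuting tuple, commuting with the entries and
with the relative inverses of all other indices. -/
structure IsRelativeInverse (T B : Fin n → H →L[ℂ] H) : Prop where
  commute : ∀ i j, Commute (T i) (T j)
  commute_inv : ∀ i j, i ≠ j → Commute (T i) (B j)
  inv_commute_inv : ∀ i j, Commute (B i) (B j)
  mul_inv_mul : ∀ i, T i * B i * T i = T i
  inv_mul_inv : ∀ i, B i * T i * B i = B i

namespace IsRelativeInverse

theorem mul_defectProd (h : IsRelativeInverse T B) {S : Finset (Fin n)} {i : Fin n} (hi : i ∈ S) :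
    T i * defectProd T B S (List.finRange n) = 0 := by
  refine mul_defectProd_eq_zero (i := i)
    (fun k hk => ⟨h.commute i k, h.commute_inv i k hk.symm⟩) ?_ (List.mem_finRange i)
  rw [defect, if_pos hi, mul_sub, mul_one, ← mul_assoc, h.mul_inv_mul, sub_self]

theorem defectProd_mul (h : IsRelativeInverse T B) {S : Finset (Fin n)} {i : Fin n} (hi : i ∉ S) :
    defectProd T B S (List.finRange n) * T i = 0 := by
  refine defectProd_mul_eq_zero (i := i)
    (fun k hk => ⟨h.commute i k, h.commute_inv i k hk.symm⟩) ?_ (List.mem_finRange i)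
  rw [defect, if_neg hi, sub_mul, one_mul, h.mul_inv_mul, sub_self]

theorem defect_mul_defectProd (h : IsRelativeInverse T B) (S : Finset (Fin n)) (i : Fin n) :
    defect (T i) (B i) (i ∈ S) * defectProd T B S (List.finRange n) =
      defectProd T B S (List.finRange n) := by
  by_cases hi : i ∈ S
  · simp only [defect, if_pos hi]
    rw [sub_mul, one_mul, mul_assoc, h.mul_defectProd hi, mul_zero, sub_zero]
  · have hB : B i * defectProd T B S (List.finRange n) = 0 := by
      refine mul_defectProd_eq_zero (i := i)
        (fun k hk => ⟨(h.commute_inv k i hk).symm, h.inv_commute_inv i k⟩) ?_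
        (List.mem_finRange i)
      rw [defect, if_neg hi, mul_sub, mul_one, ← mul_assoc, h.inv_mul_inv, sub_self]
    simp only [defect, if_neg hi]
    rw [sub_mul, one_mul, mul_assoc, hB, mul_zero, sub_zero]

theorem defectProd_idem (h : IsRelativeInverse T B) (S : Finset (Fin n)) :
    defectProd T B S (List.finRange n) * defectProd T B S (List.finRange n) =
      defectProd T B S (List.finRange n) := by
  have key : ∀ l : List (Fin n), defectProd T B S l * defectProd T B S (List.finRange n) =
      defectProd T B S (List.finRange n) := by
    intro l
    induction l with
    | nil => simp [defectProd]
    | cons j l ih =>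
      have : defectProd T B S (j :: l) = defect (T j) (B j) (j ∈ S) * defectProd T B S l := by
        simp [defectProd]
      rw [this, mul_assoc, ih, h.defect_mul_defectProd]
  exact key _

/-- Every cycle is homologous to its image under the diagonal operator with entries
`defectProd T B S l`: each factor changes it by a boundary. -/
theorem exists_sub_eq_boundary (h : IsRelativeInverse T B) {p : ℕ} {ξ : Finset (Fin n) → H}
    (hξ : ξ ∈ koszulCycles T p) (l : List (Fin n)) :
    ∃ η ∈ koszulChains H n (p + 1), ∀ S, ξ S - defectProd T B S l (ξ S) =
      koszulBoundary T η S := by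
  induction l with
  | nil => exact ⟨0, Submodule.zero_mem _, fun S => by simp [defectProd]⟩
  | cons i l ih =>
    obtain ⟨η, hη, hηS⟩ := ih
    -- By induction `ζ`, the image of `ξ` under the product over `l`, is again a cycle, so the
    -- homotopy in the variable `i` applies to it.
    let ζ : Finset (Fin n) → H := ξ - koszulBoundary T η
    have hζS : ∀ S, ζ S = defectProd T B S l (ξ S) := fun S => by
      simp only [ζ, Pi.sub_apply, ← hηS S, sub_sub_cancel]
    have hζ : ζ ∈ koszulChains H n p :=
      Submodule.sub_mem _ hξ.1 (koszulBoundary_mem_chains T hη)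
    have hdζ : koszulBoundary T ζ = 0 := by
      simp only [ζ, map_sub, koszulBoundary_comp_self h.commute, sub_zero]
      exact hξ.2
    refine ⟨η + koszulHomotopy (B i) i ζ,
      Submodule.add_mem _ hη (koszulHomotopy_mem_chains _ _ hζ), fun S => ?_⟩
    have hh := koszulBoundary_homotopy T (B i) i (fun k hk => h.commute_inv k i hk) ζ S
    have hz : koszulHomotopy (B i) i (koszulBoundary T ζ) S = 0 := by
      rw [hdζ]; simp [koszulHomotopy]
    rw [hz, add_zero] at hh
    have hcons : defectProd T B S (i :: l) (ξ S) = defect (T i) (B i) (i ∈ S) (ζ S) := by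
      rw [hζS]; simp [defectProd]
    rw [map_add, Pi.add_apply, hh, ← hηS, hcons, ← hζS]
    unfold defect
    split_ifs <;> simp <;> abel

/-- The map which induces the isomorphism of `H_p` with the sum of the ranges of the operators
`defectProd T B S`, `|S| = p`. -/
def cyclesToRange (T B : Fin n → H →L[ℂ] H) (p : ℕ) :
    koszulCycles T p →ₗ[ℂ] ((S : {S : Finset (Fin n) // S.card = p}) →
      LinearMap.range (defectProd T B S.1 (List.finRange n) : H →ₗ[ℂ] H)) :=
  LinearMap.pi fun S =>
    (defectProd T B S.1 (List.finRange n) : H →ₗ[ℂ] H).rangeRestrict ∘ₗ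
      LinearMap.proj S.1 ∘ₗ (koszulCycles T p).subtype

theorem cyclesToRange_apply (p : ℕ) (ξ : koszulCycles T p)
    (S : {S : Finset (Fin n) // S.card = p}) :
    (cyclesToRange T B p ξ S : H) = defectProd T B S.1 (List.finRange n) (ξ.1 S.1) := rfl

theorem ker_cyclesToRange (h : IsRelativeInverse T B) (p : ℕ) :
    LinearMap.ker (cyclesToRange T B p) =
      (koszulBoundaries T p).submoduleOf (koszulCycles T p) := by
  ext ξ
  rw [LinearMap.mem_ker, Submodule.submoduleOf, Submodule.mem_comap]
  constructor
  · intro hξ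
    obtain ⟨η, hη, hηS⟩ := h.exists_sub_eq_boundary ξ.2 (List.finRange n)
    refine ⟨η, hη, ?_⟩
    funext S
    rw [← hηS]
    by_cases hS : S.card = p
    · have h0 := congrArg Subtype.val (congrFun hξ ⟨S, hS⟩)
      rw [cyclesToRange_apply] at h0
      rw [h0]
      simp
    · simp [ξ.2.1 S hS]
  · rintro ⟨η, -, hη⟩
    funext S
    apply Subtype.ext
    rw [cyclesToRange_apply]
    have hξS : ξ.1 S.1 = koszulBoundary T η S.1 := congrFun hη.symm S.1
    rw [hξS, koszulBoundary_apply, map_sum]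
    refine Finset.sum_eq_zero fun i hi => ?_
    have h0 := DFunLike.congr_fun (h.defectProd_mul (Finset.mem_compl.1 hi)) (η (insert i S.1))
    simp only [mul_apply_eq_comp, zero_apply] at h0
    rw [map_smul, h0, smul_zero]

theorem cyclesToRange_surjective (h : IsRelativeInverse T B) (p : ℕ) :
    Function.Surjective (cyclesToRange T B p) := by
  intro y
  choose z hz using fun S => (y S).2
  let ξ : Finset (Fin n) → H := fun S =>
    if hS : S.card = p then defectProd T B S (List.finRange n) (z ⟨S, hS⟩) else 0
  have hξ : ξ ∈ koszulCycles T p := by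
    refine ⟨fun S hS => dif_neg hS, ?_⟩
    rw [SetLike.mem_coe, LinearMap.mem_ker]
    funext S
    rw [koszulBoundary_apply]
    refine Finset.sum_eq_zero fun i _ => ?_
    simp only [ξ]
    split_ifs with hS
    · have h0 := DFunLike.congr_fun (h.mul_defectProd (Finset.mem_insert_self i S))
        (z ⟨insert i S, hS⟩)
      simp only [mul_apply_eq_comp, zero_apply] at h0
      rw [h0, smul_zero]
    · simp
  refine ⟨⟨ξ, hξ⟩, ?_⟩
  funext S
  apply Subtype.ext
  rw [cyclesToRange_apply, ← hz S]
  simp only [ξ, dif_pos S.2]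
  exact DFunLike.congr_fun (h.defectProd_idem S.1) (z S)

/-- The Künneth decomposition of the Koszul homology of a tuple with relative inverses. -/
noncomputable def homologyEquiv (h : IsRelativeInverse T B) (p : ℕ) :
    KoszulHomology T p ≃ₗ[ℂ] ((S : {S : Finset (Fin n) // S.card = p}) →
      LinearMap.range (defectProd T B S.1 (List.finRange n) : H →ₗ[ℂ] H)) :=
  (Submodule.quotEquivOfEq _ _ (h.ker_cyclesToRange p).symm).trans
    ((cyclesToRange T B p).quotKerEquivOfSurjective (h.cyclesToRange_surjective p))

theorem isFredholmTuple (h : IsRelativeInverse T B)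
    (hfin : ∀ S, FiniteDimensional ℂ
      (LinearMap.range (defectProd T B S (List.finRange n) : H →ₗ[ℂ] H))) :
    IsFredholmTuple T :=
  ⟨h.commute, fun p _ => (h.homologyEquiv p).symm.finiteDimensional⟩

/-- The index of a tuple whose defect spaces have the dimensions of tensor products of spaces of
dimensions `k i` (kernels) and `c i` (cokernels). -/
theorem tupleIndex_eq (h : IsRelativeInverse T B)
    (hfin : ∀ S, FiniteDimensional ℂ
      (LinearMap.range (defectProd T B S (List.finRange n) : H →ₗ[ℂ] H))) (k c : Fin n → ℕ)
    (hdim : ∀ S, Module.finrank ℂ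
      (LinearMap.range (defectProd T B S (List.finRange n) : H →ₗ[ℂ] H)) =
        ∏ i, if i ∈ S then k i else c i) :
    tupleIndex T = (-1) ^ (n + 1) * ∏ i, ((k i : ℤ) - c i) := by
  have hp : ∀ p, (Module.finrank ℂ (KoszulHomology T p) : ℤ) =
      ∑ S ∈ (Finset.univ : Finset (Fin n)).powersetCard p,
        ∏ i, if i ∈ S then (k i : ℤ) else c i := by
    intro p
    rw [(h.homologyEquiv p).finrank_eq, Module.finrank_pi_fintype]
    simp only [hdim]
    push_cast
    rw [← Finset.sum_subtype (p := fun S : Finset (Fin n) => S.card = p)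
      ((Finset.univ : Finset (Fin n)).powersetCard p) (by simp)
      (fun S => ∏ i, if i ∈ S then (k i : ℤ) else c i)]
  -- The sign `(-1) ^ |S|` goes into the kernel factors; the sum over `S` is then the expansion of
  -- `∏ i, (c i - k i)`.
  have hsum : ∀ S : Finset (Fin n), (-1 : ℤ) ^ S.card * ∏ i, (if i ∈ S then (k i : ℤ) else c i) =
      (∏ i ∈ S, (-(k i : ℤ))) * ∏ i ∈ Finset.univ \ S, (c i : ℤ) := by
    intro S
    rw [Finset.prod_neg, mul_assoc, Finset.prod_ite]
    congr 3 <;> ext i <;> simp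
  have hneg : ∏ i, ((k i : ℤ) - c i) = (-1) ^ n * ∏ i, (-(k i : ℤ) + c i) := by
    have := Finset.prod_neg (s := (Finset.univ : Finset (Fin n))) (f := fun i => -(k i : ℤ) + c i)
    rw [Finset.card_univ, Fintype.card_fin] at this
    rw [← this]
    exact Finset.prod_congr rfl fun i _ => by ring
  rw [hneg, ← mul_assoc, pow_succ, mul_neg_one, neg_mul, ← pow_add, Even.neg_one_pow ⟨n, rfl⟩,
    Finset.prod_add]
  unfold tupleIndex
  rw [Finset.sum_powerset, Finset.card_univ, Fintype.card_fin, neg_mul, one_mul,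
    ← Finset.sum_neg_distrib]
  refine Finset.sum_congr rfl fun p _ => ?_
  rw [hp, Finset.mul_sum, ← Finset.sum_neg_distrib]
  refine Finset.sum_congr rfl fun S hS => ?_
  rw [← hsum, (Finset.mem_powersetCard.1 hS).2, pow_succ]
  ring

end IsRelativeInverse

end Kunneth

/-! ### Compactness in the Koszul complex of a Fredholm tuple -/

section Topology

open Filter Topology

/-- If `Z / (B ∩ Z)` is finite dimensional, it is represented by a subspace of `Z` which is
independent of `B`. -/
theorem exists_finiteDimensional_complement {E : Type*} [AddCommGroup E] [Module ℂ E]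
    (Z B : Submodule ℂ E) [FiniteDimensional ℂ (Z ⧸ B.submoduleOf Z)] :
    ∃ F : Submodule ℂ E, FiniteDimensional ℂ F ∧ F ≤ Z ∧ Disjoint F B ∧ Z ≤ B ⊔ F := by
  obtain ⟨C, hC⟩ := (B.submoduleOf Z).exists_isCompl
  have hCfin : FiniteDimensional ℂ C :=
    (Submodule.quotientEquivOfIsCompl _ _ hC).finiteDimensional
  refine ⟨C.map Z.subtype, inferInstance, Submodule.map_subtype_le _ _, ?_, ?_⟩
  · rw [Submodule.disjoint_def]
    rintro _ ⟨c, hc, rfl⟩ hB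
    have : c = 0 := (Submodule.disjoint_def.1 hC.disjoint) c hB hc
    simp [this]
  · intro z hz
    have : (⟨z, hz⟩ : Z) ∈ B.submoduleOf Z ⊔ C := by rw [hC.sup_eq_top]; trivial
    obtain ⟨b, hb, c, hc, hbc⟩ := Submodule.mem_sup.1 this
    exact Submodule.mem_sup.2 ⟨b, hb, c, ⟨c, hc, rfl⟩, congrArg Subtype.val hbc⟩

/-- A complex on a Banach space with finite dimensional homology has closed range, and is therefore
proper modulo boundaries: a bounded sequence of approximate cycles has, up to bounded boundaries, a
convergent subsequence. -/
theorem exists_subseq_tendsto_sub_boundary {E : Type*} [NormedAddCommGroup E] [NormedSpace ℂ E]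
    [CompleteSpace E] (d : E →L[ℂ] E) (hd : ∀ x, d (d x) = 0) (F : Submodule ℂ E)
    [FiniteDimensional ℂ F] (hFker : F ≤ LinearMap.ker (d : E →ₗ[ℂ] E))
    (hdisj : Disjoint F (LinearMap.range (d : E →ₗ[ℂ] E)))
    (hsup : LinearMap.ker (d : E →ₗ[ℂ] E) ≤ LinearMap.range (d : E →ₗ[ℂ] E) ⊔ F)
    (ξ : ℕ → E) (hξ : ∀ k, ‖ξ k‖ ≤ 1) (hdξ : Tendsto (fun k => d (ξ k)) atTop (𝓝 0)) :
    ∃ (φ : ℕ → ℕ) (η : ℕ → E) (C : ℝ) (f : E), StrictMono φ ∧ (∀ k, ‖η k‖ ≤ C) ∧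
      Tendsto (fun k => ξ (φ k) - d (η k)) atTop (𝓝 f) := by
  set Z := LinearMap.ker (d : E →ₗ[ℂ] E) with hZ
  have : CompleteSpace Z := (ContinuousLinearMap.isClosed_ker d).completeSpace_coe
  have : CompleteSpace F := FiniteDimensional.complete ℂ F
  -- The open mapping theorem for `(x, f) ↦ d x + f` gives liftings with norm control.
  let Φ : E × F →L[ℂ] Z :=
    (d ∘L ContinuousLinearMap.fst ℂ E F + F.subtypeL ∘L ContinuousLinearMap.snd ℂ E F).codRestrict
      Z (fun x => Submodule.add_mem _ (hd x.1) (hFker x.2.2))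
  have hΦ : Function.Surjective Φ := by
    rintro ⟨z, hz⟩
    obtain ⟨_, ⟨x, rfl⟩, f, hf, hxf⟩ := Submodule.mem_sup.1 (hsup hz)
    exact ⟨(x, ⟨f, hf⟩), Subtype.ext hxf⟩
  obtain ⟨C, hC0, hC⟩ := Φ.exists_preimage_norm_le hΦ
  have hlift : ∀ z ∈ Z, ∃ (x : E) (f : F), d x + f = z ∧ ‖x‖ ≤ C * ‖z‖ ∧ ‖f‖ ≤ C * ‖z‖ := by
    intro z hz
    obtain ⟨⟨x, f⟩, hxf, hle⟩ := hC ⟨z, hz⟩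
    exact ⟨x, f, congrArg Subtype.val hxf, (norm_fst_le (x, f)).trans hle,
      (norm_snd_le (x, f)).trans hle⟩
  have hθ : ∀ k, ∃ θ : E, d θ = d (ξ k) ∧ ‖θ‖ ≤ C * ‖d (ξ k)‖ := by
    intro k
    obtain ⟨x, f, hxf, hx, -⟩ := hlift (d (ξ k)) (hd _)
    -- The component in `F` of a boundary is a boundary, hence zero.
    have hf0 : (f : E) = 0 := by
      refine (Submodule.disjoint_def.1 hdisj) f f.2 ⟨ξ k - x, ?_⟩
      rw [ContinuousLinearMap.coe_coe, map_sub, ← hxf, add_sub_cancel_left]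
    exact ⟨x, by rw [← hxf, hf0, add_zero], hx⟩
  choose θ hθd hθn using hθ
  have hcyc : ∀ k, ξ k - θ k ∈ Z := fun k => by
    change d (ξ k - θ k) = 0
    rw [map_sub, hθd, sub_self]
  choose η f hηf hηn hfn using fun k => hlift _ (hcyc k)
  set M := C * (1 + C * ‖d‖) with hM
  have hbd : ∀ k, C * ‖ξ k - θ k‖ ≤ M := by
    intro k
    have h1 : ‖d (ξ k)‖ ≤ ‖d‖ := d.unit_le_opNorm _ (hξ k)
    have h2 : ‖θ k‖ ≤ C * ‖d‖ := (hθn k).trans (by gcongr)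
    have h3 : ‖ξ k - θ k‖ ≤ 1 + C * ‖d‖ := (norm_sub_le _ _).trans (add_le_add (hξ k) h2)
    exact mul_le_mul_of_nonneg_left h3 hC0.le
  have : ProperSpace F := FiniteDimensional.proper ℂ F
  obtain ⟨g, -, φ, hφ, hg⟩ := tendsto_subseq_of_bounded (x := f)
    (Metric.isBounded_closedBall (x := (0 : F)) (r := M))
    (fun k => by simpa using (hfn k).trans (hbd k))
  have hθ0 : Tendsto θ atTop (𝓝 0) := by
    refine squeeze_zero_norm hθn ?_
    simpa using hdξ.norm.const_mul C
  refine ⟨φ, fun k => η (φ k), M, g, hφ, fun k => (hηn _).trans (hbd _), ?_⟩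
  have hlim : Tendsto (fun k => θ (φ k) + (f (φ k) : E)) atTop (𝓝 (0 + (g : E))) :=
    (hθ0.comp hφ.tendsto_atTop).add ((continuous_subtype_val.tendsto g).comp hg)
  rw [zero_add] at hlim
  refine hlim.congr fun k => ?_
  have := hηf (φ k)
  rw [sub_eq_iff_eq_add.1 this.symm]
  abel

end Topology

section KoszulTopology

open Filter Topology

variable {H : Type*} [NormedAddCommGroup H] {n : ℕ}

/-- The total homology of the Koszul complex of a Fredholm tuple, with all degrees taken together,
is finite dimensional: it is spanned by finitely many cycles, which can be chosen independent
modulo boundaries. -/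
theorem exists_complement_of_isFredholmTuple [NormedSpace ℂ H] {T : Fin n → H →L[ℂ] H}
    (hT : IsFredholmTuple T) :
    ∃ F : Submodule ℂ (Finset (Fin n) → H), FiniteDimensional ℂ F ∧
      F ≤ LinearMap.ker (koszulBoundary T) ∧ Disjoint F (LinearMap.range (koszulBoundary T)) ∧
      LinearMap.ker (koszulBoundary T) ≤ LinearMap.range (koszulBoundary T) ⊔ F := by
  have hdeg : ∀ p : Fin (n + 1), ∃ F : Submodule ℂ (Finset (Fin n) → H), FiniteDimensional ℂ F ∧
      F ≤ koszulCycles T p ∧ koszulCycles T p ≤ koszulBoundaries T p ⊔ F := by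
    intro p
    have := hT.finite_homology p (Nat.lt_succ_iff.1 p.2)
    obtain ⟨F, h1, h2, -, h3⟩ :=
      exists_finiteDimensional_complement (koszulCycles T p) (koszulBoundaries T p)
    exact ⟨F, h1, h2, h3⟩
  choose F hFfin hFle hFsup using hdeg
  have hle : (⨆ p, F p) ≤ LinearMap.ker (koszulBoundary T) :=
    iSup_le fun p => (hFle p).trans inf_le_right
  have hsup : LinearMap.ker (koszulBoundary T) ≤
      LinearMap.range (koszulBoundary T) ⊔ ⨆ p, F p := by
    intro ξ hξ
    -- The homogeneous components of a cycle are cycles.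
    let c : Fin (n + 1) → Finset (Fin n) → H := fun p S => if S.card = p then ξ S else 0
    have hsum : ξ = ∑ p, c p := by
      funext S
      have hS : S.card < n + 1 := Nat.lt_succ_iff.2 (by simpa using S.card_le_univ)
      rw [Finset.sum_apply, Finset.sum_eq_single (⟨S.card, hS⟩ : Fin (n + 1))]
      · simp [c]
      · intro p _ hp
        simp only [c]
        exact if_neg fun h => hp (Fin.ext h.symm)
      · simp
    have hc : ∀ p : Fin (n + 1), c p ∈ koszulCycles T p := by
      intro p
      refine ⟨fun S hS => if_neg hS, ?_⟩
      rw [SetLike.mem_coe, LinearMap.mem_ker]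
      funext S
      have hξS := congrFun (LinearMap.mem_ker.1 hξ) S
      rw [koszulBoundary_apply] at hξS ⊢
      by_cases hS : S.card + 1 = p
      · rw [← hξS]
        refine Finset.sum_congr rfl fun i hi => ?_
        simp only [c]
        rw [if_pos (by rw [Finset.card_insert_of_notMem (Finset.mem_compl.1 hi), hS])]
      · refine Finset.sum_eq_zero fun i hi => ?_
        simp only [c]
        rw [if_neg (by rwa [Finset.card_insert_of_notMem (Finset.mem_compl.1 hi)])]
        simp
    rw [hsum]
    refine Submodule.sum_mem _ fun p _ => ?_
    exact sup_le_sup (LinearMap.map_le_range) (le_iSup F p) (hFsup p (hc p))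
  have hquot : FiniteDimensional ℂ (LinearMap.ker (koszulBoundary T) ⧸
      (LinearMap.range (koszulBoundary T)).submoduleOf (LinearMap.ker (koszulBoundary T))) := by
    refine Module.Finite.of_surjective (Submodule.mkQ _ ∘ₗ Submodule.inclusion hle) ?_
    intro y
    obtain ⟨⟨ξ, hξ⟩, rfl⟩ := Submodule.mkQ_surjective _ y
    obtain ⟨b, hb, f, hf, hbf⟩ := Submodule.mem_sup.1 (hsup hξ)
    refine ⟨⟨f, hf⟩, ?_⟩
    rw [LinearMap.comp_apply, ← sub_eq_zero, ← map_sub, Submodule.mkQ_apply,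
      Submodule.Quotient.mk_eq_zero]
    change f - ξ ∈ LinearMap.range (koszulBoundary T)
    rw [← hbf, sub_add_cancel_right]
    exact Submodule.neg_mem _ hb
  exact exists_finiteDimensional_complement _ _

variable [InnerProductSpace ℂ H] [CompleteSpace H]

/-- The approximate harmonic vectors of a Fredholm tuple are compact in every component of the
Koszul complex: no orthonormal sequence is asymptotically annihilated by the `T_i` with `i ∈ S` and
by the adjoints of the `T_i` with `i ∉ S`. -/
theorem IsFredholmTuple.not_orthonormal {T : Fin n → H →L[ℂ] H} (hT : IsFredholmTuple T)
    (S : Finset (Fin n)) {v : ℕ → H} (hv : Orthonormal ℂ v)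
    (hin : ∀ i ∈ S, Tendsto (fun k => T i (v k)) atTop (𝓝 0))
    (hout : ∀ i ∉ S, Tendsto (fun k => ContinuousLinearMap.adjoint (T i) (v k)) atTop (𝓝 0)) :
    False := by
  obtain ⟨F, hF, hFker, hdisj, hsup⟩ := exists_complement_of_isFredholmTuple hT
  let d : (Finset (Fin n) → H) →L[ℂ] (Finset (Fin n) → H) :=
    ⟨koszulBoundary T, by
      refine continuous_pi fun S => ?_
      change Continuous fun ξ => koszulBoundary T ξ S
      simp only [koszulBoundary_apply]
      fun_prop⟩
  have hdξ : Tendsto (fun k => d (Pi.single S (v k))) atTop (𝓝 0) := by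
    rw [tendsto_pi_nhds]
    intro R
    change Tendsto (fun k => koszulBoundary T (Pi.single S (v k)) R) atTop (𝓝 0)
    simp only [koszulBoundary_apply]
    rw [← Finset.sum_const_zero (s := Rᶜ)]
    refine tendsto_finsetSum _ fun i _ => ?_
    by_cases h : insert i R = S
    · subst h
      simpa using (hin i (Finset.mem_insert_self i R)).const_smul
        ((-1 : ℂ) ^ (R.filter (fun j => j < i)).card)
    · simp [Pi.single_eq_of_ne h]
  obtain ⟨φ, η, C, f, hφ, hη, hlim⟩ := exists_subseq_tendsto_sub_boundary d
    (koszulBoundary_comp_self hT.commute) F hFker hdisj hsup (fun k => Pi.single S (v k))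
    (fun k => by rw [Pi.norm_single, hv.1 k]) hdξ
  have hlimS : Tendsto (fun k => v (φ k) - koszulBoundary T (η k) S) atTop (𝓝 (f S)) := by
    simpa [d] using! (tendsto_pi_nhds.1 hlim) S
  -- Consecutive differences have norm `√2`, but they are close to boundaries, to which they are
  -- almost orthogonal.
  let w : ℕ → H := fun k => v (φ k) - v (φ (k + 1))
  have hw : ∀ k, inner ℂ (w k) (w k) = (2 : ℂ) := by
    intro k
    have hne : φ k ≠ φ (k + 1) := (hφ (Nat.lt_succ_self k)).ne
    have h1 := orthonormal_iff_ite.1 hv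
    simp only [w, inner_sub_left, inner_sub_right, h1, if_true, if_neg hne, if_neg hne.symm]
    norm_num
  have hwn : ∀ k, ‖w k‖ ≤ 2 := fun k =>
    (norm_sub_le _ _).trans (by rw [hv.1, hv.1]; norm_num)
  let u : ℕ → H := fun k => v (φ k) - koszulBoundary T (η k) S
  have hu : Tendsto (fun k => u k - u (k + 1)) atTop (𝓝 0) := by
    simpa using hlimS.sub (hlimS.comp (tendsto_add_atTop_nat 1))
  have hA : Tendsto (fun k => inner ℂ (w k) (u k - u (k + 1))) atTop (𝓝 0) := by
    refine squeeze_zero_norm (a := fun k => 2 * ‖u k - u (k + 1)‖) (fun k => ?_) ?_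
    · exact (norm_inner_le_norm _ _).trans (by gcongr; exact hwn k)
    · simpa using hu.norm.const_mul 2
  have hB : Tendsto (fun k => inner ℂ (w k) (koszulBoundary T (η k - η (k + 1)) S)) atTop
      (𝓝 0) := by
    simp only [koszulBoundary_apply, inner_sum, inner_smul_right]
    rw [← Finset.sum_const_zero (s := Sᶜ)]
    refine tendsto_finsetSum _ fun i hi => ?_
    have hiS := hout i (Finset.mem_compl.1 hi)
    have hwi : Tendsto (fun k => ContinuousLinearMap.adjoint (T i) (w k)) atTop (𝓝 0) := by
      simpa [w] using (hiS.comp hφ.tendsto_atTop).sub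
        (hiS.comp (hφ.tendsto_atTop.comp (tendsto_add_atTop_nat 1)))
    rw [← mul_zero ((-1 : ℂ) ^ (S.filter (fun j => j < i)).card)]
    refine Tendsto.const_mul _ ?_
    refine squeeze_zero_norm
      (a := fun k => ‖ContinuousLinearMap.adjoint (T i) (w k)‖ * (C + C)) (fun k => ?_) ?_
    · rw [← ContinuousLinearMap.adjoint_inner_left]
      refine (norm_inner_le_norm _ _).trans ?_
      gcongr
      exact (norm_le_pi_norm _ _).trans ((norm_sub_le _ _).trans (add_le_add (hη _) (hη _)))
    · simpa using hwi.norm.mul_const (C + C)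
  have hsum := hA.add hB
  rw [add_zero] at hsum
  have hconst : ∀ k, inner ℂ (w k) (u k - u (k + 1)) +
      inner ℂ (w k) (koszulBoundary T (η k - η (k + 1)) S) = (2 : ℂ) := by
    intro k
    rw [← inner_add_right, ← hw k]
    congr 1
    simp only [u, w, map_sub, Pi.sub_apply]
    abel
  simp only [hconst] at hsum
  exact two_ne_zero (tendsto_nhds_unique tendsto_const_nhds hsum)

end KoszulTopology

/-! ### Singular sequences and relative inverses of one operator -/

section OneOperator

open Filter Topology ContinuousLinearMap

variable {H : Type*} [NormedAddCommGroup H] [InnerProductSpace ℂ H]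

/-- An operator is bounded below on the orthogonal complement of a finite dimensional subspace
unless it has an orthonormal sequence of approximate null vectors. -/
theorem exists_orthonormal_of_not_boundedBelow (T : H →L[ℂ] H)
    (hT : ¬ ∃ F : Submodule ℂ H, FiniteDimensional ℂ F ∧ ∃ c > 0, ∀ x ∈ Fᗮ, c * ‖x‖ ≤ ‖T x‖) :
    ∃ v : ℕ → H, Orthonormal ℂ v ∧ Tendsto (fun k => T (v k)) atTop (𝓝 0) := by
  push Not at hT
  -- The sequence is built together with the bounds `1 / (m + 1)`, whose indices `m` increase.
  obtain ⟨f, hfP, hfr⟩ := exists_seq_of_forall_finset_exists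
    (fun a : ℕ × H => ‖a.2‖ = 1 ∧ ‖T a.2‖ ≤ 1 / ((a.1 : ℝ) + 1))
    (fun a b => a.1 < b.1 ∧ inner ℂ a.2 b.2 = 0) (by
      classical
      intro s _
      set m := s.sup Prod.fst + 1 with hm
      have hpos : (0 : ℝ) < 1 / ((m : ℝ) + 1) := by positivity
      obtain ⟨x, hx, hTx⟩ := hT (Submodule.span ℂ (s.image Prod.snd : Finset H))
        (FiniteDimensional.span_finset ℂ _) _ hpos
      have hx0 : x ≠ 0 := by rintro rfl; simp at hTx
      have hxn : ‖x‖ ≠ 0 := norm_ne_zero_iff.2 hx0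
      have hn : ‖((‖x‖⁻¹ : ℝ) : ℂ)‖ = ‖x‖⁻¹ := by simp
      refine ⟨(m, ((‖x‖⁻¹ : ℝ) : ℂ) • x), ⟨?_, ?_⟩, fun a ha => ⟨?_, ?_⟩⟩
      · rw [norm_smul, hn, inv_mul_cancel₀ hxn]
      · rw [map_smul, norm_smul, hn, inv_mul_le_iff₀ (by positivity), mul_comm]
        exact hTx.le
      · exact Nat.lt_succ_of_le (Finset.le_sup (f := Prod.fst) ha)
      · rw [inner_smul_right, Submodule.inner_right_of_mem_orthogonal
          (Submodule.subset_span (by simpa using ⟨a.1, ha⟩)) hx, mul_zero])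
  refine ⟨fun k => (f k).2, ⟨fun k => (hfP k).1, fun i j hij => ?_⟩, ?_⟩
  · rcases lt_or_gt_of_ne hij with h | h
    · exact (hfr i j h).2
    · exact inner_eq_zero_symm.1 (hfr j i h).2
  · have hmono : StrictMono fun k => (f k).1 := fun i j h => (hfr i j h).1
    exact squeeze_zero_norm (fun k => (hfP k).2)
      (tendsto_one_div_add_atTop_nhds_zero_nat.comp hmono.tendsto_atTop)

theorem range_one_sub_inv_mul {T B : H →L[ℂ] H} (h : T * B * T = T) :
    LinearMap.range ((1 - B * T : H →L[ℂ] H) : H →ₗ[ℂ] H) =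
      LinearMap.ker (T : H →ₗ[ℂ] H) := by
  ext x
  constructor
  · rintro ⟨y, rfl⟩
    have h0 : T * (1 - B * T) = 0 := by rw [mul_sub, mul_one, ← mul_assoc, h, sub_self]
    exact DFunLike.congr_fun h0 y
  · intro hx
    refine ⟨x, ?_⟩
    have hx' : T x = 0 := hx
    simp [hx']

/-- The range of the projection `1 - T B` is isomorphic to the cokernel of `T`, as it is a
complement of the range of `T`. -/
noncomputable def rangeOneSubMulInvEquiv {T B : H →L[ℂ] H} (h : T * B * T = T) :
    (H ⧸ LinearMap.range (T : H →ₗ[ℂ] H)) ≃ₗ[ℂ]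
      LinearMap.range ((1 - T * B : H →L[ℂ] H) : H →ₗ[ℂ] H) :=
  (Submodule.quotEquivOfEq _ _ (by
    ext x
    constructor
    · rintro ⟨y, rfl⟩
      have h0 : (1 - T * B) * T = 0 := by rw [sub_mul, one_mul, h, sub_self]
      exact DFunLike.congr_fun h0 y
    · intro hx
      have hx' : x - T (B x) = 0 := hx
      exact ⟨B x, (sub_eq_zero.1 hx').symm⟩)).trans
    (LinearMap.quotKerEquivRange ((1 - T * B : H →L[ℂ] H) : H →ₗ[ℂ] H))

/-- The inverse of `T` between complements of its kernel and of its cokernel, extended by zero. -/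
theorem exists_relativeInverse {T : H →L[ℂ] H} (hT : T.IsFredholm) :
    ∃ B : H →L[ℂ] H, T * B * T = T ∧ B * T * B = B := by
  obtain ⟨pkg⟩ := hT.nonempty_fredholmPackage
  have hT' : ∀ x, T x = (pkg.equiv (pkg.decDom.proj x) : H) := fun x =>
    DFunLike.congr_fun pkg.eq_equiv x
  have hB : ∀ x, pkg.quasiInverse x = (pkg.equiv.symm (pkg.decCodom.proj x) : H) := fun x => rfl
  have hproj : ∀ (dec : FredholmDecomposition ℂ H) (x : dec.X₁), dec.proj (x : H) = x :=
    fun dec x => Submodule.projectionOnto_apply_left _ x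
  refine ⟨pkg.quasiInverse, ?_, ?_⟩
  · ext x
    simp only [mul_apply_eq_comp, hT', hB]
    rw [hproj, hproj, ContinuousLinearEquiv.apply_symm_apply]
  · ext x
    simp only [mul_apply_eq_comp, hT', hB]
    rw [hproj, hproj, ContinuousLinearEquiv.symm_apply_apply]

variable [CompleteSpace H]

/-- An operator bounded below, together with its adjoint, on subspaces of finite codimension is
Fredholm. -/
theorem isFredholm_of_boundedBelow (T : H →L[ℂ] H)
    (h₁ : ∃ F : Submodule ℂ H, FiniteDimensional ℂ F ∧ ∃ c > 0, ∀ x ∈ Fᗮ, c * ‖x‖ ≤ ‖T x‖)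
    (h₂ : ∃ F : Submodule ℂ H, FiniteDimensional ℂ F ∧
      ∃ c > 0, ∀ x ∈ Fᗮ, c * ‖x‖ ≤ ‖adjoint T x‖) :
    T.IsFredholm := by
  have hker : ∀ R : H →L[ℂ] H,
      (∃ F : Submodule ℂ H, FiniteDimensional ℂ F ∧ ∃ c > 0, ∀ x ∈ Fᗮ, c * ‖x‖ ≤ ‖R x‖) →
      FiniteDimensional ℂ R.ker := by
    rintro R ⟨F, hF, c, hc, hR⟩
    have : (Fᗮ).CoFG :=
      (Submodule.quotientEquivOfIsCompl _ _ F.isCompl_orthogonal.symm).symm.finiteDimensional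
    refine .of_fg (this.fg_of_disjoint (Submodule.disjoint_def.2 fun x hx hxF => ?_))
    have h0 := hR x hxF
    rw [show R x = 0 from hx, norm_zero] at h0
    exact norm_le_zero_iff.1 (le_of_mul_le_mul_left (by simpa using h0) hc)
  have hfin := hker T h₁
  have hfin' := hker _ h₂
  obtain ⟨F, hF, c, hc, hT⟩ := h₁
  have hco : (Fᗮ).CoFG :=
    (Submodule.quotientEquivOfIsCompl _ _ F.isCompl_orthogonal.symm).symm.finiteDimensional
  have hanti : AntilipschitzWith (⟨c⁻¹, by positivity⟩ : NNReal) (T.domRestrict Fᗮ) := by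
    refine AddMonoidHomClass.antilipschitz_of_bound _ fun x => ?_
    have := hT x x.2
    change ‖(x : H)‖ ≤ c⁻¹ * ‖T x‖
    rwa [le_inv_mul_iff₀ hc]
  have hstrict := (T.isStrictMap_isClosed_range_iff_restrict Fᗮ F.isClosed_orthogonal).2
    ⟨(hanti.isClosedEmbedding (T.domRestrict Fᗮ).uniformContinuous).isEmbedding.isStrictMap,
      hanti.isClosed_range (T.domRestrict Fᗮ).uniformContinuous⟩
  have : CompleteSpace T.range := hstrict.2.completeSpace_coe
  refine ⟨hstrict.1, hstrict.2, hfin, ?_, ?_⟩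
  · rw [← T.orthogonal_range] at hfin'
    exact (Submodule.quotientEquivOfIsCompl _ _
      T.range.isCompl_orthogonal).symm.finiteDimensional
  · exact Submodule.ClosedComplemented.of_finiteDimensional _

/-- A non-Fredholm operator or its adjoint has an orthonormal sequence of approximate null
vectors. -/
theorem exists_orthonormal_of_not_isFredholm {T : H →L[ℂ] H} (hT : ¬ T.IsFredholm) :
    ∃ (b : Bool) (v : ℕ → H), Orthonormal ℂ v ∧
      Tendsto (fun k => (bif b then T else adjoint T) (v k)) atTop (𝓝 0) := by
  by_contra hcon
  push Not at hcon
  refine hT (isFredholm_of_boundedBelow T ?_ ?_)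
  · by_contra h
    obtain ⟨v, hv, hlim⟩ := exists_orthonormal_of_not_boundedBelow T h
    exact hcon true v hv hlim
  · by_contra h
    obtain ⟨v, hv, hlim⟩ := exists_orthonormal_of_not_boundedBelow _ h
    exact hcon false v hv hlim

/-- A non-invertible operator or its adjoint has a sequence of approximate null unit vectors. -/
theorem exists_unit_of_not_isUnit {T : H →L[ℂ] H} (hT : ¬ IsUnit T) :
    ∃ (b : Bool) (v : ℕ → H), (∀ k, ‖v k‖ = 1) ∧
      Tendsto (fun k => (bif b then T else adjoint T) (v k)) atTop (𝓝 0) := by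
  have hseq : ∀ R : H →L[ℂ] H, (¬ ∃ c > 0, ∀ x, c * ‖x‖ ≤ ‖R x‖) →
      ∃ v : ℕ → H, (∀ k, ‖v k‖ = 1) ∧ Tendsto (fun k => R (v k)) atTop (𝓝 0) := by
    intro R hR
    push Not at hR
    have hx : ∀ k : ℕ, ∃ x : H, ‖x‖ = 1 ∧ ‖R x‖ ≤ 1 / ((k : ℝ) + 1) := by
      intro k
      obtain ⟨x, hRx⟩ := hR (1 / ((k : ℝ) + 1)) (by positivity)
      have hx0 : x ≠ 0 := by rintro rfl; simp at hRx
      have hxn : ‖x‖ ≠ 0 := norm_ne_zero_iff.2 hx0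
      have hn : ‖((‖x‖⁻¹ : ℝ) : ℂ)‖ = ‖x‖⁻¹ := by simp
      refine ⟨((‖x‖⁻¹ : ℝ) : ℂ) • x, ?_, ?_⟩
      · rw [norm_smul, hn, inv_mul_cancel₀ hxn]
      · rw [map_smul, norm_smul, hn, inv_mul_le_iff₀ (by positivity), mul_comm]
        exact hRx.le
    choose v hv hRv using hx
    exact ⟨v, hv, squeeze_zero_norm hRv tendsto_one_div_add_atTop_nhds_zero_nat⟩
  by_contra hcon
  push Not at hcon
  refine hT (ContinuousLinearMap.isUnit_iff_bijective.2
    ((bijective_iff_dense_range_and_antilipschitz T).2 ⟨?_, ?_⟩))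
  · by_cases h : ∃ c > 0, ∀ x, c * ‖x‖ ≤ ‖adjoint T x‖
    · obtain ⟨c, hc, h⟩ := h
      rw [Submodule.topologicalClosure_eq_top_iff, T.orthogonal_range, Submodule.eq_bot_iff]
      intro x hx
      have h0 := h x
      rw [show adjoint T x = 0 from hx, norm_zero] at h0
      exact norm_le_zero_iff.1 (le_of_mul_le_mul_left (by simpa using h0) hc)
    · obtain ⟨v, hv, hlim⟩ := hseq _ h
      exact absurd hlim (hcon false v hv)
  · by_cases h : ∃ c > 0, ∀ x, c * ‖x‖ ≤ ‖T x‖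
    · obtain ⟨c, hc, h⟩ := h
      exact ⟨⟨c⁻¹, by positivity⟩, AddMonoidHomClass.antilipschitz_of_bound _ fun x =>
        (le_inv_mul_iff₀ hc).2 (h x)⟩
    · obtain ⟨v, hv, hlim⟩ := hseq _ h
      exact absurd hlim (hcon true v hv)

end OneOperator

/-! ### Hilbert tensor products and operators on a single factor -/

section HilbertTensor

open ContinuousLinearMap

variable {H K : Type*} [NormedAddCommGroup H] [InnerProductSpace ℂ H] [NormedAddCommGroup K]
  [InnerProductSpace ℂ K] {n : ℕ}

/-- A multilinear map `τ` which exhibits `K` as the Hilbert space tensor product of `n` copies of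
`H`, up to completion: inner products of pure tensors multiply and pure tensors are total. -/
structure IsHilbertTensor (τ : MultilinearMap ℂ (fun _ : Fin n => H) K) : Prop where
  inner_map : ∀ x y, inner ℂ (τ x) (τ y) = ∏ i, inner ℂ (x i) (y i)
  eq_zero_of_inner : ∀ w, (∀ x, inner ℂ (τ x) w = 0) → w = 0

namespace IsHilbertTensor

variable {τ : MultilinearMap ℂ (fun _ : Fin n => H) K}

theorem norm_map (h : IsHilbertTensor τ) (x : Fin n → H) : ‖τ x‖ = ∏ i, ‖x i‖ := by
  have h1 : ((‖τ x‖ : ℂ)) ^ 2 = ((∏ i, ‖x i‖ : ℝ) : ℂ) ^ 2 := by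
    have h2 := h.inner_map x x
    simp only [inner_self_eq_norm_sq_to_K] at h2
    rw [Finset.prod_pow] at h2
    exact_mod_cast h2
  have h2 : ‖τ x‖ ^ 2 = (∏ i, ‖x i‖) ^ 2 := by exact_mod_cast h1
  exact (pow_left_inj₀ (norm_nonneg _) (Finset.prod_nonneg fun i _ => norm_nonneg _)
    two_ne_zero).1 h2

/-- Bounded operators which agree on pure tensors are equal. -/
theorem ext (h : IsHilbertTensor τ) {R R' : K →L[ℂ] K} [CompleteSpace K]
    (hR : ∀ x, R (τ x) = R' (τ x)) : R = R' := by
  have hadj : ∀ w, adjoint (R - R') w = 0 := fun w => h.eq_zero_of_inner _ fun x => by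
    rw [adjoint_inner_right, sub_apply, hR, sub_self, inner_zero_left]
  refine sub_eq_zero.1 ((LinearIsometryEquiv.map_eq_zero_iff adjoint).1 ?_)
  exact ContinuousLinearMap.ext hadj

theorem eq_top_of_forall_mem (h : IsHilbertTensor τ) [CompleteSpace K] {W : Submodule ℂ K}
    (hW : IsClosed (W : Set K)) (hmem : ∀ x, τ x ∈ W) : W = ⊤ := by
  rw [← hW.submodule_topologicalClosure_eq, Submodule.topologicalClosure_eq_top_iff,
    Submodule.eq_bot_iff]
  exact fun w hw => h.eq_zero_of_inner w fun x => hw _ (hmem x)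

/-- A pure tensor, as a function of a single factor, is continuous. -/
noncomputable def slotCLM (h : IsHilbertTensor τ) (x : Fin n → H) (i : Fin n) : H →L[ℂ] K :=
  (τ.toLinearMap x i).mkContinuous (∏ j ∈ Finset.univ.erase i, ‖x j‖) fun y => by
    rw [MultilinearMap.toLinearMap_apply, h.norm_map,
      ← Finset.mul_prod_erase _ _ (Finset.mem_univ i), Function.update_self, mul_comm]
    refine le_of_eq (congrArg (· * ‖y‖) (Finset.prod_congr rfl fun j hj => ?_))
    rw [Function.update_of_ne (Finset.ne_of_mem_erase hj)]

theorem slotCLM_apply (h : IsHilbertTensor τ) (x : Fin n → H) (i : Fin n) (y : H) :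
    h.slotCLM x i y = τ (Function.update x i y) := rfl

/-- The tensors of basis vectors are already total: the factors are exchanged one at a time, using
continuity in each of them. -/
theorem eq_zero_of_inner_basis (h : IsHilbertTensor τ) {κ : Type*} (b : HilbertBasis κ ℂ H)
    (w : K) (hw : ∀ k : Fin n → κ, inner ℂ w (τ fun j => b (k j)) = 0) : w = 0 := by
  have key : ∀ s : Finset (Fin n), ∀ x : Fin n → H, (∀ j ∉ s, ∃ k, x j = b k) →
      inner ℂ w (τ x) = 0 := by
    intro s
    induction s using Finset.induction_on with
    | empty =>
      intro x hx
      choose k hk using fun j => hx j (Finset.notMem_empty j)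
      rw [show x = fun j => b (k j) from funext hk]
      exact hw k
    | insert a s ha ih =>
      intro x hx
      let φ : H →L[ℂ] ℂ := innerSL ℂ w ∘L h.slotCLM x a
      have hφ : φ = 0 := by
        refine ContinuousLinearMap.ext_on (s := Set.range b)
          (Submodule.dense_iff_topologicalClosure_eq_top.2 b.dense_span) ?_
        rintro _ ⟨k, rfl⟩
        refine ih _ fun j hj => ?_
        by_cases hja : j = a
        · subst hja
          exact ⟨k, Function.update_self ..⟩
        · rw [Function.update_of_ne hja]
          exact hx j (by simp [hja, hj])
      have := DFunLike.congr_fun hφ (x a)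
      simpa [φ, slotCLM_apply] using this
  refine h.eq_zero_of_inner w fun x => inner_eq_zero_symm.1 (key Finset.univ x fun j hj => ?_)
  exact absurd (Finset.mem_univ j) hj

/-- The range of a tensor product of finite rank operators is spanned by the tensors of orthonormal
bases of the ranges of the factors. -/
theorem finrank_range [CompleteSpace K] (h : IsHilbertTensor τ) {R : K →L[ℂ] K}
    {E : Fin n → H →L[ℂ] H}
    (hR : ∀ x, R (τ x) = τ fun i => E i (x i))
    (hE : ∀ i, FiniteDimensional ℂ (LinearMap.range (E i : H →ₗ[ℂ] H))) :
    FiniteDimensional ℂ (LinearMap.range (R : K →ₗ[ℂ] K)) ∧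
      Module.finrank ℂ (LinearMap.range (R : K →ₗ[ℂ] K)) =
        ∏ i, Module.finrank ℂ (LinearMap.range (E i : H →ₗ[ℂ] H)) := by
  let u := fun i => stdOrthonormalBasis ℂ (LinearMap.range (E i : H →ₗ[ℂ] H))
  let t : ((i : Fin n) → Fin (Module.finrank ℂ (LinearMap.range (E i : H →ₗ[ℂ] H)))) → K :=
    fun k => τ fun i => (u i (k i) : H)
  have ht : Orthonormal ℂ t := by
    rw [orthonormal_iff_ite]
    intro k k'
    simp only [t, h.inner_map, ← Submodule.coe_inner]
    simp only [orthonormal_iff_ite.1 (u _).orthonormal]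
    split_ifs with hkk'
    · exact Finset.prod_eq_one fun i _ => if_pos (congrFun hkk' i)
    · obtain ⟨i, hi⟩ := Function.ne_iff.1 hkk'
      exact Finset.prod_eq_zero (Finset.mem_univ i) (if_neg hi)
  have hfin : FiniteDimensional ℂ (Submodule.span ℂ (Set.range t)) :=
    FiniteDimensional.span_of_finite ℂ (Set.finite_range t)
  have hspan : LinearMap.range (R : K →ₗ[ℂ] K) = Submodule.span ℂ (Set.range t) := by
    refine le_antisymm ?_ ?_
    · have htop : (Submodule.span ℂ (Set.range t)).comap (R : K →ₗ[ℂ] K) = ⊤ := by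
        have hclosed : IsClosed (R ⁻¹' (Submodule.span ℂ (Set.range t) : Set K)) :=
          (Submodule.closed_of_finiteDimensional _).preimage R.continuous
        refine h.eq_top_of_forall_mem hclosed fun x => ?_
        rw [Submodule.mem_comap, ContinuousLinearMap.coe_coe, hR]
        have hx : (fun i => E i (x i)) = fun i =>
            ∑ j, (u i).repr ⟨E i (x i), x i, rfl⟩ j • (u i j : H) := by
          funext i
          have := congrArg Subtype.val ((u i).sum_repr ⟨E i (x i), x i, rfl⟩)
          rw [Submodule.coe_sum] at this
          exact this.symm
        rw [hx, MultilinearMap.map_sum]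
        refine Submodule.sum_mem _ fun k _ => ?_
        rw [MultilinearMap.map_smul_univ]
        exact Submodule.smul_mem _ _ (Submodule.subset_span ⟨k, rfl⟩)
      rintro _ ⟨y, rfl⟩
      exact (htop ▸ Submodule.mem_top : y ∈ (Submodule.span ℂ (Set.range t)).comap _)
    · rw [Submodule.span_le]
      rintro _ ⟨k, rfl⟩
      choose y hy using fun i => (u i (k i)).2
      exact ⟨τ y, (hR y).trans (congrArg τ (funext hy))⟩
  rw [hspan]
  refine ⟨hfin, ?_⟩
  rw [finrank_span_eq_card ht.linearIndependent, Fintype.card_pi]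
  simp

section Lift

variable {κ : Type*} (b : HilbertBasis κ ℂ H) (i : Fin n)

/-- Basis vectors in all factors but the `i`-th, and a free vector in the `i`-th one. -/
noncomputable def fiberTuple (k : {j : Fin n // j ≠ i} → κ) (x : H) : Fin n → H := fun j =>
  if hj : j = i then x else b (k ⟨j, hj⟩)

theorem fiberTuple_self (k : {j : Fin n // j ≠ i} → κ) (x : H) : fiberTuple b i k x i = x :=
  dif_pos rfl

theorem fiberTuple_of_ne (k : {j : Fin n // j ≠ i} → κ) (x : H) {j : Fin n} (hj : j ≠ i) :
    fiberTuple b i k x j = b (k ⟨j, hj⟩) := dif_neg hj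

theorem fiberTuple_eq_update (k : {j : Fin n // j ≠ i} → κ) (x : H) :
    fiberTuple b i k x = Function.update (fiberTuple b i k 0) i x := by
  funext j
  by_cases hj : j = i
  · subst hj; rw [fiberTuple_self, Function.update_self]
  · rw [Function.update_of_ne hj, fiberTuple_of_ne b i k x hj, fiberTuple_of_ne b i k 0 hj]

theorem inner_fiberTuple (h : IsHilbertTensor τ) (k : {j : Fin n // j ≠ i} → κ) (x : H)
    (y : Fin n → H) :
    inner ℂ (τ (fiberTuple b i k x)) (τ y) =
      inner ℂ x (y i) * ∏ j : {j : Fin n // j ≠ i}, inner ℂ (b (k j)) (y j) := by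
  rw [h.inner_map, ← Finset.mul_prod_erase _ _ (Finset.mem_univ i), fiberTuple_self]
  congr 1
  rw [Finset.prod_subtype (p := fun j => j ≠ i) (Finset.univ.erase i) (by simp)
    (fun j => inner ℂ (fiberTuple b i k x j) (y j))]
  refine Finset.prod_congr rfl fun j _ => ?_
  rw [fiberTuple_of_ne b i k x j.2]

/-- The isometric embeddings of `H` as fibers over the basis vectors of the other factors. -/
noncomputable def fiberIsometry (h : IsHilbertTensor τ) (k : {j : Fin n // j ≠ i} → κ) :
    H →ₗᵢ[ℂ] K where
  toLinearMap := τ.toLinearMap (fiberTuple b i k 0) i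
  norm_map' x := by
    rw [MultilinearMap.toLinearMap_apply, ← fiberTuple_eq_update, h.norm_map,
      ← Finset.mul_prod_erase _ _ (Finset.mem_univ i), fiberTuple_self, Finset.prod_eq_one,
      mul_one]
    intro j hj
    rw [fiberTuple_of_ne b i k x (Finset.ne_of_mem_erase hj)]
    exact b.orthonormal.1 _

theorem fiberIsometry_apply (h : IsHilbertTensor τ) (k : {j : Fin n // j ≠ i} → κ) (x : H) :
    h.fiberIsometry b i k x = τ (fiberTuple b i k x) := by
  rw [fiberTuple_eq_update]; rfl

theorem orthogonalFamily_fiberIsometry (h : IsHilbertTensor τ) :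
    OrthogonalFamily ℂ (fun _ : {j : Fin n // j ≠ i} → κ => H) (h.fiberIsometry b i) := by
  intro k k' hkk' x y
  rw [fiberIsometry_apply, fiberIsometry_apply, h.inner_fiberTuple]
  obtain ⟨j, hj⟩ := Function.ne_iff.1 hkk'
  rw [Finset.prod_eq_zero (Finset.mem_univ j), mul_zero]
  rw [fiberTuple_of_ne b i k' y j.2]
  exact b.orthonormal.2 hj

variable [CompleteSpace H] [CompleteSpace K]

/-- `K` is the Hilbert sum of the fibers. -/
theorem isHilbertSum_fiberIsometry (h : IsHilbertTensor τ) :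
    IsHilbertSum ℂ (fun _ : {j : Fin n // j ≠ i} → κ => H) (h.fiberIsometry b i) := by
  refine IsHilbertSum.mk (h.orthogonalFamily_fiberIsometry b i) ?_
  rw [top_le_iff, Submodule.topologicalClosure_eq_top_iff, Submodule.eq_bot_iff]
  intro w hw
  refine h.eq_zero_of_inner_basis b w fun k => ?_
  refine inner_eq_zero_symm.1 (hw _ ?_)
  refine Submodule.mem_iSup_of_mem (fun j => k j) ⟨b (k i), ?_⟩
  change h.fiberIsometry b i _ _ = _
  rw [fiberIsometry_apply]
  congr 1
  funext j
  by_cases hj : j = i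
  · subst hj; rw [fiberTuple_self]
  · rw [fiberTuple_of_ne _ _ _ _ hj]

end Lift

/-- A bounded operator applied to each entry of a square summable family. -/
noncomputable def ampliation (ι : Type*) (A : H →L[ℂ] H) :
    lp (fun _ : ι => H) 2 →L[ℂ] lp (fun _ : ι => H) 2 :=
  have hbd : ∀ (f : lp (fun _ : ι => H) 2) (k : ι), ‖A (f k)‖ ≤ ‖((‖A‖ : ℂ) • f) k‖ :=
    fun f k => by
      rw [lp.coeFn_smul, Pi.smul_apply, norm_smul]
      simpa using A.le_opNorm (f k)
  have hmem : ∀ f : lp (fun _ : ι => H) 2, Memℓp (fun k => A (f k)) 2 := fun f =>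
    (lp.memℓp ((‖A‖ : ℂ) • f)).mono' (hbd f)
  LinearMap.mkContinuous
    { toFun := fun f => ⟨fun k => A (f k), hmem f⟩
      map_add' := fun f g => by ext k; exact map_add A (f k) (g k)
      map_smul' := fun c f => by ext k; exact map_smul A c (f k) }
    ‖A‖ fun f => by
      have h1 := lp.norm_mono (p := 2) (by norm_num)
        (x := (⟨fun k => A (f k), hmem f⟩ : lp (fun _ : ι => H) 2)) (y := (‖A‖ : ℂ) • f)
        (hbd f)
      rwa [norm_smul, Complex.norm_real, norm_norm] at h1

theorem ampliation_apply {ι : Type*} (A : H →L[ℂ] H) (f : lp (fun _ : ι => H) 2) (k : ι) :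
    ampliation ι A f k = A (f k) := rfl

variable [CompleteSpace H] [CompleteSpace K]

/-- Every bounded operator on `H` acts on the `i`-th factor: `K` is a Hilbert sum of copies of `H`
indexed by the basis tensors of the other factors, and the operator acts in each copy. -/
theorem exists_lift (h : IsHilbertTensor τ) (i : Fin n) (A : H →L[ℂ] H) :
    ∃ R : K →L[ℂ] K, ∀ x, R (τ x) = τ (Function.update x i (A (x i))) := by
  classical
  obtain ⟨s, b, -⟩ := exists_hilbertBasis ℂ H
  let e := (h.isHilbertSum_fiberIsometry b i).linearIsometryEquiv
  -- The `k`-th coordinate of `v` is its image under the adjoint of the `k`-th embedding, so every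
  -- coordinate of a pure tensor `τ x` is a multiple of `x i`.
  have hcoord : ∀ (v : K) (k : {j : Fin n // j ≠ i} → s) (a : H),
      inner ℂ a (e v k) = inner ℂ (τ (fiberTuple b i k a)) v := by
    intro v k a
    refine (lp.inner_single_left (𝕜 := ℂ) k a (e v)).symm.trans ?_
    have h1 := e.inner_map_map (e.symm (lp.single 2 k a)) v
    rw [LinearIsometryEquiv.apply_symm_apply] at h1
    rw [h1, IsHilbertSum.linearIsometryEquiv_symm_apply_single, fiberIsometry_apply]
  have hτ : ∀ (x : Fin n → H) (k : {j : Fin n // j ≠ i} → s),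
      e (τ x) k = (∏ j : {j : Fin n // j ≠ i}, inner ℂ (b (k j)) (x j)) • x i := by
    intro x k
    refine ext_inner_left ℂ fun a => ?_
    rw [hcoord, h.inner_fiberTuple, inner_smul_right, mul_comm]
  refine ⟨e.symm.toContinuousLinearEquiv.toContinuousLinearMap ∘L ampliation _ A ∘L
    e.toContinuousLinearEquiv.toContinuousLinearMap, fun x => ?_⟩
  change e.symm (ampliation _ A (e (τ x))) = _
  rw [LinearIsometryEquiv.symm_apply_eq]
  ext k
  rw [ampliation_apply, hτ, hτ, map_smul, Function.update_self]
  congr 1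
  refine Finset.prod_congr rfl fun j _ => ?_
  rw [Function.update_of_ne j.2]

/-- The operator `1 ⊗ ⋯ ⊗ A ⊗ ⋯ ⊗ 1` with `A` in the `i`-th factor. -/
noncomputable def lift (h : IsHilbertTensor τ) (i : Fin n) (A : H →L[ℂ] H) : K →L[ℂ] K :=
  (h.exists_lift i A).choose

theorem lift_apply (h : IsHilbertTensor τ) (i : Fin n) (A : H →L[ℂ] H) (x : Fin n → H) :
    h.lift i A (τ x) = τ (Function.update x i (A (x i))) :=
  (h.exists_lift i A).choose_spec x

theorem lift_mul (h : IsHilbertTensor τ) (i : Fin n) (A A' : H →L[ℂ] H) :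
    h.lift i (A * A') = h.lift i A * h.lift i A' :=
  h.ext fun x => by
    rw [mul_apply_eq_comp, lift_apply, lift_apply, lift_apply, Function.update_self,
      Function.update_idem]
    rfl

theorem lift_one_sub (h : IsHilbertTensor τ) (i : Fin n) (A : H →L[ℂ] H) :
    h.lift i (1 - A) = 1 - h.lift i A :=
  h.ext fun x => by
    rw [sub_apply, lift_apply, lift_apply, sub_apply, one_apply_eq_self, one_apply_eq_self,
      MultilinearMap.map_update_sub, Function.update_eq_self]

theorem lift_commute (h : IsHilbertTensor τ) {i j : Fin n} (hij : i ≠ j) (A A' : H →L[ℂ] H) :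
    Commute (h.lift i A) (h.lift j A') :=
  h.ext fun x => by
    rw [mul_apply_eq_comp, mul_apply_eq_comp, lift_apply, lift_apply, lift_apply, lift_apply,
      Function.update_of_ne hij, Function.update_of_ne hij.symm, Function.update_comm hij]

theorem lift_commute_self (h : IsHilbertTensor τ) (i j : Fin n) (A : Fin n → H →L[ℂ] H) :
    Commute (h.lift i (A i)) (h.lift j (A j)) := by
  by_cases hij : i = j
  · subst hij; exact Commute.refl _
  · exact h.lift_commute hij _ _

theorem adjoint_lift (h : IsHilbertTensor τ) (i : Fin n) (A : H →L[ℂ] H) :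
    adjoint (h.lift i A) = h.lift i (adjoint A) := by
  refine h.ext fun x => ?_
  refine sub_eq_zero.1 (h.eq_zero_of_inner _ fun y => ?_)
  rw [inner_sub_right, adjoint_inner_right, lift_apply, lift_apply, h.inner_map, h.inner_map,
    sub_eq_zero]
  refine Finset.prod_congr rfl fun j _ => ?_
  by_cases hj : j = i
  · subst hj
    rw [Function.update_self, Function.update_self, adjoint_inner_right]
  · rw [Function.update_of_ne hj, Function.update_of_ne hj]

/-- A product of lifts over distinct factors acts factor by factor. -/
theorem list_prod_lift_apply (h : IsHilbertTensor τ) (A : Fin n → H →L[ℂ] H) (x : Fin n → H)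
    {l : List (Fin n)} (hl : l.Nodup) :
    (l.map fun i => h.lift i (A i)).prod (τ x) =
      τ fun i => if i ∈ l then A i (x i) else x i := by
  induction l with
  | nil => simp
  | cons j l ih =>
    rw [List.nodup_cons] at hl
    rw [List.map_cons, List.prod_cons, mul_apply_eq_comp, ih hl.2, lift_apply, if_neg hl.1]
    congr 1
    funext i
    by_cases hi : i = j
    · subst hi; simp
    · simp [hi]

end IsHilbertTensor

end HilbertTensor

/-! ### Tuples of operators on the factors of a tensor product -/

namespace IsHilbertTensor

section Tuple

open Filter Topology ContinuousLinearMap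

variable {H K : Type*} [NormedAddCommGroup H] [InnerProductSpace ℂ H] [NormedAddCommGroup K]
  [InnerProductSpace ℂ K] [CompleteSpace H] [CompleteSpace K] {n : ℕ}
  {τ : MultilinearMap ℂ (fun _ : Fin n => H) K}

theorem norm_lift_apply (h : IsHilbertTensor τ) (i : Fin n) (A : H →L[ℂ] H) {x : Fin n → H}
    (hx : ∀ j, ‖x j‖ = 1) : ‖h.lift i A (τ x)‖ = ‖A (x i)‖ := by
  rw [lift_apply, h.norm_map, Finset.prod_eq_single i, Function.update_self]
  · intro j _ hj
    rw [Function.update_of_ne hj, hx]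
  · simp

/-- If the tuple of lifts of non-invertible operators is Fredholm, so is each operator: otherwise
the tensors of a singular sequence in one factor with approximate null vectors in the others would
be an orthonormal sequence of approximate harmonic vectors. -/
theorem isFredholm_of_isFredholmTuple (h : IsHilbertTensor τ) {A : Fin n → H →L[ℂ] H}
    (hA : ∀ i, ¬ IsUnit (A i)) (hT : IsFredholmTuple fun i => h.lift i (A i)) (i : Fin n) :
    (A i).IsFredholm := by
  by_contra hi
  have hseq : ∀ j, ∃ (b : Bool) (v : ℕ → H), (∀ k, ‖v k‖ = 1) ∧ (j = i → Orthonormal ℂ v) ∧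
      Tendsto (fun k => (bif b then A j else adjoint (A j)) (v k)) atTop (𝓝 0) := by
    intro j
    by_cases hj : j = i
    · subst hj
      obtain ⟨b, v, hv, hlim⟩ := exists_orthonormal_of_not_isFredholm hi
      exact ⟨b, v, hv.1, fun _ => hv, hlim⟩
    · obtain ⟨b, v, hv, hlim⟩ := exists_unit_of_not_isUnit (hA j)
      exact ⟨b, v, hv, fun h => absurd h hj, hlim⟩
  choose b v hv hvi hlim using hseq
  refine hT.not_orthonormal (Finset.univ.filter fun j => b j = true)
    (v := fun k => τ fun j => v j k) ?_ ?_ ?_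
  · refine ⟨fun k => ?_, fun k l hkl => ?_⟩
    · rw [h.norm_map]
      exact Finset.prod_eq_one fun j _ => hv j k
    · change inner ℂ (τ fun j => v j k) (τ fun j => v j l) = 0
      rw [h.inner_map]
      exact Finset.prod_eq_zero (Finset.mem_univ i) ((hvi i rfl).2 hkl)
  · intro j hj
    have hb : b j = true := by simpa using hj
    have hl := hlim j
    rw [hb, cond_true] at hl
    rw [tendsto_zero_iff_norm_tendsto_zero] at hl ⊢
    exact hl.congr fun k => (h.norm_lift_apply j (A j) fun i => hv i k).symm
  · intro j hj
    have hb : b j = false := by simpa using hj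
    have hl := hlim j
    rw [hb, cond_false] at hl
    rw [tendsto_zero_iff_norm_tendsto_zero] at hl ⊢
    refine hl.congr fun k => ?_
    rw [h.adjoint_lift]
    exact (h.norm_lift_apply j _ fun i => hv i k).symm

/-- Lifts of Fredholm operators form a Fredholm tuple, whose index is given by the Künneth
formula. -/
theorem isFredholmTuple_and_index (h : IsHilbertTensor τ) {A : Fin n → H →L[ℂ] H}
    (hA : ∀ i, (A i).IsFredholm) :
    IsFredholmTuple (fun i => h.lift i (A i)) ∧
      tupleIndex (fun i => h.lift i (A i)) = (-1) ^ (n + 1) * ∏ i, fredholmIndex (A i) := by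
  -- `H / ran A_i` has no canonical lift to `H`; it is represented by the range of `1 - A_i B_i`.
  choose B hABA hBAB using fun i => exists_relativeInverse (hA i)
  have hrel : IsRelativeInverse (fun i => h.lift i (A i)) (fun i => h.lift i (B i)) :=
    { commute := fun i j => h.lift_commute_self i j A
      commute_inv := fun i j hij => h.lift_commute hij _ _
      inv_commute_inv := fun i j => h.lift_commute_self i j B
      mul_inv_mul := fun i => by rw [← lift_mul, ← lift_mul, hABA]
      inv_mul_inv := fun i => by rw [← lift_mul, ← lift_mul, hBAB] }
  have hdefect : ∀ (S : Finset (Fin n)) i, defect (h.lift i (A i)) (h.lift i (B i)) (i ∈ S) =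
      h.lift i (defect (A i) (B i) (i ∈ S)) := by
    intro S i
    unfold defect
    split_ifs
    · rw [lift_one_sub, lift_mul]
    · rw [lift_one_sub, lift_mul]
  have hprod : ∀ (S : Finset (Fin n)) x,
      defectProd (fun i => h.lift i (A i)) (fun i => h.lift i (B i)) S (List.finRange n) (τ x) =
        τ fun i => defect (A i) (B i) (i ∈ S) (x i) := by
    intro S x
    unfold defectProd
    simp only [hdefect]
    rw [h.list_prod_lift_apply (fun i => defect (A i) (B i) (i ∈ S)) x (List.nodup_finRange n)]
    simp only [List.mem_finRange, if_true]
  have hone : ∀ (S : Finset (Fin n)) i,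
      FiniteDimensional ℂ (LinearMap.range (defect (A i) (B i) (i ∈ S) : H →ₗ[ℂ] H)) ∧
      Module.finrank ℂ (LinearMap.range (defect (A i) (B i) (i ∈ S) : H →ₗ[ℂ] H)) =
        if i ∈ S then Module.finrank ℂ (LinearMap.ker (A i : H →ₗ[ℂ] H))
        else Module.finrank ℂ (H ⧸ LinearMap.range (A i : H →ₗ[ℂ] H)) := by
    intro S i
    by_cases hi : i ∈ S
    · have hd : defect (A i) (B i) (i ∈ S) = 1 - B i * A i := if_pos hi
      rw [hd, if_pos hi, range_one_sub_inv_mul (hABA i)]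
      exact ⟨(hA i).finite_ker, rfl⟩
    · have hd : defect (A i) (B i) (i ∈ S) = 1 - A i * B i := if_neg hi
      have := (hA i).finite_coker
      rw [hd, if_neg hi]
      exact ⟨(rangeOneSubMulInvEquiv (hABA i)).finiteDimensional,
        (rangeOneSubMulInvEquiv (hABA i)).finrank_eq.symm⟩
  have hrange := fun S => h.finrank_range (hprod S) fun i => (hone S i).1
  refine ⟨hrel.isFredholmTuple fun S => (hrange S).1, ?_⟩
  refine hrel.tupleIndex_eq (fun S => (hrange S).1) _ _ fun S => ?_
  rw [(hrange S).2]
  exact Finset.prod_congr rfl fun i _ => (hone S i).2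

end Tuple

end IsHilbertTensor

/-! ### Hardy spaces and Toeplitz operators -/

section Concrete

open UnitAddTorus

variable {n : ℕ}

/-- Products of one-variable functions respect almost everywhere equality in each variable, because
the coordinate projections of the torus preserve the measures. -/
theorem ae_eq_prod_comp_eval {g g' : Fin n → UnitAddCircle → ℂ}
    (h : ∀ i, g i =ᵐ[haarAddCircle] g' i) :
    (fun z : UnitAddTorus (Fin n) => ∏ i, g i (z i)) =ᵐ[torusMeasure n]
      fun z => ∏ i, g' i (z i) := by
  have h' : ∀ i, ∀ᵐ z ∂(torusMeasure n), g i (z i) = g' i (z i) := fun i =>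
    (measurePreserving_eval (fun _ => (haarAddCircle : Measure UnitAddCircle))
      i).quasiMeasurePreserving.ae (h i)
  filter_upwards [ae_all_iff.2 h'] with z hz
  exact Finset.prod_congr rfl fun i _ => hz i

theorem memLp_prod_comp_eval {g : Fin n → UnitAddCircle → ℂ}
    (h : ∀ i, MemLp (g i) 2 haarAddCircle) :
    MemLp (fun z : UnitAddTorus (Fin n) => ∏ i, g i (z i)) 2 (torusMeasure n) := by
  have hm : AEStronglyMeasurable (fun z : UnitAddTorus (Fin n) => ∏ i, g i (z i))
      (torusMeasure n) :=
    Finset.aestronglyMeasurable_fun_prod _ fun i _ =>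
      (h i).1.comp_quasiMeasurePreserving (measurePreserving_eval
        (fun _ => (haarAddCircle : Measure UnitAddCircle)) i).quasiMeasurePreserving
  rw [memLp_two_iff_integrable_sq_norm hm]
  simp only [norm_prod, ← Finset.prod_pow]
  exact Integrable.fintype_prod fun i => (memLp_two_iff_integrable_sq_norm (h i).1).1 (h i)

/-- The function `(z_1, …, z_n) ↦ g_1(z_1) ⋯ g_n(z_n)` in `L²(𝕋ⁿ)`. -/
noncomputable def tensorLp (g : Fin n → Lp ℂ 2 (haarAddCircle : Measure UnitAddCircle)) :
    Lp ℂ 2 (torusMeasure n) :=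
  (memLp_prod_comp_eval fun i => Lp.memLp (g i)).toLp _

theorem coeFn_tensorLp (g : Fin n → Lp ℂ 2 (haarAddCircle : Measure UnitAddCircle)) :
    tensorLp g =ᵐ[torusMeasure n] fun z => ∏ i, g i (z i) :=
  MemLp.coeFn_toLp _

theorem inner_tensorLp (g g' : Fin n → Lp ℂ 2 (haarAddCircle : Measure UnitAddCircle)) :
    inner ℂ (tensorLp g) (tensorLp g') = ∏ i, inner ℂ (g i) (g' i) := by
  simp only [L2.inner_def]
  rw [← integral_fintype_prod_eq_prod (fun i (t : UnitAddCircle) => inner ℂ (g i t) (g' i t))]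
  refine integral_congr_ae ?_
  filter_upwards [coeFn_tensorLp g, coeFn_tensorLp g'] with z h1 h2
  rw [h1, h2]
  simp only [RCLike.inner_apply, map_prod, ← Finset.prod_mul_distrib]

theorem prod_update_apply (g : Fin n → UnitAddCircle → ℂ) (i : Fin n) (a : UnitAddCircle → ℂ)
    (z : UnitAddTorus (Fin n)) :
    ∏ j, Function.update g i a j (z j) = a (z i) * ∏ j ∈ Finset.univ.erase i, g j (z j) := by
  rw [← Finset.mul_prod_erase _ _ (Finset.mem_univ i), Function.update_self]
  congr 1
  refine Finset.prod_congr rfl fun j hj => ?_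
  rw [Function.update_of_ne (Finset.ne_of_mem_erase hj)]

theorem coeFn_tensorLp_update (g : Fin n → Lp ℂ 2 (haarAddCircle : Measure UnitAddCircle))
    (i : Fin n) (a : Lp ℂ 2 (haarAddCircle : Measure UnitAddCircle)) {a' : UnitAddCircle → ℂ}
    (ha : a =ᵐ[haarAddCircle] a') :
    tensorLp (Function.update g i a) =ᵐ[torusMeasure n] fun z =>
      a' (z i) * ∏ j ∈ Finset.univ.erase i, g j (z j) := by
  have h1 := ae_eq_prod_comp_eval
    (g := fun j => (Function.update g i a j : UnitAddCircle → ℂ))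
    (g' := Function.update (fun j => (g j : UnitAddCircle → ℂ)) i a') (fun j => by
      by_cases hj : j = i
      · subst hj; simpa using ha
      · simp [Function.update_of_ne hj])
  filter_upwards [coeFn_tensorLp (Function.update g i a), h1] with z h2 h3
  rw [h2, h3, prod_update_apply]

/-- Products of one-variable functions, as a multilinear map. -/
noncomputable def tensorLpMultilinear (n : ℕ) :
    MultilinearMap ℂ (fun _ : Fin n => Lp ℂ 2 (haarAddCircle : Measure UnitAddCircle))
      (Lp ℂ 2 (torusMeasure n)) :=
  MultilinearMap.mk' tensorLp
    (fun g i a a' => by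
      refine Lp.ext ?_
      filter_upwards [coeFn_tensorLp_update g i _ (Lp.coeFn_add a a'),
        Lp.coeFn_add (tensorLp (Function.update g i a)) (tensorLp (Function.update g i a')),
        coeFn_tensorLp_update g i a .rfl, coeFn_tensorLp_update g i a' .rfl] with z h1 h2 h3 h4
      rw [h1, h2, Pi.add_apply, Pi.add_apply, h3, h4, add_mul])
    (fun g i c a => by
      refine Lp.ext ?_
      filter_upwards [coeFn_tensorLp_update g i _ (Lp.coeFn_smul c a),
        Lp.coeFn_smul c (tensorLp (Function.update g i a)),
        coeFn_tensorLp_update g i a .rfl] with z h1 h2 h3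
      rw [h1, h2, Pi.smul_apply, Pi.smul_apply, h3, smul_mul_assoc])

/-- Multiplication by `f(z_i)` acts on the `i`-th factor of a product. -/
theorem holder_symbolInVariable (i : Fin n)
    (f : Lp ℂ ∞ (haarAddCircle : Measure UnitAddCircle))
    (g : Fin n → Lp ℂ 2 (haarAddCircle : Measure UnitAddCircle)) :
    (ContinuousLinearMap.mul ℂ ℂ).holderL (torusMeasure n) ∞ 2 2 (symbolInVariable i f)
        (tensorLp g) =
      tensorLp (Function.update g i
        ((ContinuousLinearMap.mul ℂ ℂ).holderL haarAddCircle ∞ 2 2 f (g i))) := by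
  refine Lp.ext ?_
  have h1 := (ContinuousLinearMap.mul ℂ ℂ).coeFn_holder (r := 2) (symbolInVariable i f)
    (tensorLp g)
  have h2 := coeFn_tensorLp_update g i _
    ((ContinuousLinearMap.mul ℂ ℂ).coeFn_holder (r := 2) f (g i))
  have h3 := Lp.coeFn_compMeasurePreserving f
    (measurePreserving_eval (fun _ : Fin n => (haarAddCircle : Measure UnitAddCircle)) i)
  filter_upwards [h1, h2, h3, coeFn_tensorLp g] with z h1 h2 h3 h4
  refine h1.trans (Eq.trans ?_ h2.symm)
  simp only [ContinuousLinearMap.mul_apply']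
  rw [h4, show symbolInVariable i f z = f (z i) from h3, mul_assoc,
    Finset.mul_prod_erase _ (fun j => g j (z j)) (Finset.mem_univ i)]

theorem toLp_mFourier (k : Fin n → ℤ) :
    ContinuousMap.toLp (E := ℂ) 2 (torusMeasure n) ℂ (mFourier k) =
      tensorLp fun i => fourierLp (T := (1 : ℝ)) 2 (k i) := by
  refine Lp.ext ?_
  filter_upwards [ContinuousMap.coeFn_toLp (p := 2) (𝕜 := ℂ) (torusMeasure n) (mFourier k),
    coeFn_tensorLp fun i => fourierLp (T := (1 : ℝ)) 2 (k i),
    ae_eq_prod_comp_eval fun i => coeFn_fourierLp (T := 1) 2 (k i)] with z h1 h2 h3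
  rw [h1, h2, h3]
  rfl

/-- The closed span of part of a Hilbert basis consists of the vectors orthogonal to the rest of
the basis. -/
theorem mem_topologicalClosure_span_image_iff {E ι : Type*} [NormedAddCommGroup E]
    [InnerProductSpace ℂ E] (b : HilbertBasis ι ℂ E) (s : Set ι) (x : E) :
    x ∈ (Submodule.span ℂ (b '' s)).topologicalClosure ↔ ∀ k ∉ s, inner ℂ (b k) x = 0 := by
  constructor
  · intro hx k hk
    have hle : (Submodule.span ℂ (b '' s)).topologicalClosure ≤ (ℂ ∙ b k)ᗮ := by
      refine Submodule.topologicalClosure_minimal _ (Submodule.span_le.2 ?_)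
        (Submodule.isClosed_orthogonal _)
      rintro _ ⟨l, hl, rfl⟩
      refine Submodule.mem_orthogonal_singleton_iff_inner_right.2 (b.orthonormal.2 ?_)
      rintro rfl
      exact hk hl
    exact Submodule.mem_orthogonal_singleton_iff_inner_right.1 (hle hx)
  · intro hx
    have hsum := b.hasSum_repr x
    refine (Submodule.isClosed_topologicalClosure _).mem_of_tendsto hsum
      (Filter.Eventually.of_forall fun t => Submodule.sum_mem _ fun k _ => ?_)
    by_cases hk : k ∈ s
    · exact Submodule.smul_mem _ _
        (Submodule.le_topologicalClosure _ (Submodule.subset_span ⟨k, hk, rfl⟩))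
    · rw [b.repr_apply_apply, hx k hk, zero_smul]
      exact Submodule.zero_mem _

theorem mem_hardyDisk_iff (x : Lp ℂ 2 (haarAddCircle : Measure UnitAddCircle)) :
    x ∈ hardyDisk ↔ ∀ k : ℤ, k < 0 → inner ℂ (fourierLp (T := (1 : ℝ)) 2 k) x = 0 := by
  have h := mem_topologicalClosure_span_image_iff (fourierBasis (T := (1 : ℝ))) {k | 0 ≤ k} x
  rw [coe_fourierBasis] at h
  simpa using! h

theorem mem_hardyPolydisk_iff (x : Lp ℂ 2 (torusMeasure n)) :
    x ∈ hardyPolydisk n ↔ ∀ k : Fin n → ℤ, (¬ ∀ i, 0 ≤ k i) →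
      inner ℂ (tensorLp fun i => fourierLp (T := (1 : ℝ)) 2 (k i)) x = 0 := by
  have h := mem_topologicalClosure_span_image_iff (mFourierBasis (d := Fin n))
    {k | ∀ i, 0 ≤ k i} x
  rw [coe_mFourierBasis] at h
  simp only [← toLp_mFourier]
  exact h

theorem tensorLp_mem_hardyPolydisk {g : Fin n → Lp ℂ 2 (haarAddCircle : Measure UnitAddCircle)}
    (hg : ∀ i, g i ∈ hardyDisk) : tensorLp g ∈ hardyPolydisk n := by
  rw [mem_hardyPolydisk_iff]
  intro k hk
  push Not at hk
  obtain ⟨i, hi⟩ := hk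
  rw [inner_tensorLp]
  exact Finset.prod_eq_zero (Finset.mem_univ i) ((mem_hardyDisk_iff _).1 (hg i) _ hi)

theorem fourierLp_mem_hardyDisk {k : ℤ} (hk : 0 ≤ k) :
    fourierLp (T := (1 : ℝ)) 2 k ∈ hardyDisk :=
  Submodule.le_topologicalClosure _ (Submodule.subset_span ⟨k, hk, rfl⟩)

/-- A vector of the Hardy space of the polydisk is determined by its inner products with
products of monomials. -/
theorem inner_eq_zero_of_mem_hardyPolydisk {w : Lp ℂ 2 (torusMeasure n)}
    (hw : ∀ k : Fin n → ℤ, (∀ i, 0 ≤ k i) →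
      inner ℂ (tensorLp fun i => fourierLp (T := (1 : ℝ)) 2 (k i)) w = 0)
    {v : Lp ℂ 2 (torusMeasure n)} (hv : v ∈ hardyPolydisk n) : inner ℂ v w = 0 := by
  have hle : hardyPolydisk n ≤ (ℂ ∙ w)ᗮ := by
    refine Submodule.topologicalClosure_minimal _ (Submodule.span_le.2 ?_)
      (Submodule.isClosed_orthogonal _)
    rintro _ ⟨k, hk, rfl⟩
    refine Submodule.mem_orthogonal_singleton_iff_inner_left.2 ?_
    simp only [toLp_mFourier]
    exact hw k hk
  exact Submodule.mem_orthogonal_singleton_iff_inner_left.1 (hle hv)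

/-- The projection onto the Hardy space of the polydisk acts factor by factor. -/
theorem orthogonalProjection_tensorLp
    (g : Fin n → Lp ℂ 2 (haarAddCircle : Measure UnitAddCircle)) :
    ((hardyPolydisk n).orthogonalProjectionOnto (tensorLp g) : Lp ℂ 2 (torusMeasure n)) =
      tensorLp fun i => (hardyDisk.orthogonalProjectionOnto (g i) : Lp ℂ 2 haarAddCircle) := by
  refine Submodule.eq_starProjection_of_mem_of_inner_eq_zero (K := hardyPolydisk n)
    (tensorLp_mem_hardyPolydisk fun i => Submodule.coe_mem _) fun w hw => ?_
  -- It suffices to pair the difference with products of monomials, where the inner products are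
  -- products of one-variable inner products, unchanged by the one-variable projections.
  rw [← inner_conj_symm, inner_eq_zero_of_mem_hardyPolydisk (fun k hk => ?_) hw, map_zero]
  rw [inner_sub_right, inner_tensorLp, inner_tensorLp, sub_eq_zero]
  refine Finset.prod_congr rfl fun i _ => ?_
  have h0 := Submodule.inner_left_of_mem_orthogonal (fourierLp_mem_hardyDisk (hk i))
    (Submodule.sub_starProjection_mem_orthogonal (K := hardyDisk) (g i))
  rw [← inner_conj_symm, map_eq_zero, inner_sub_right, sub_eq_zero] at h0
  exact h0

/-- Products of functions in the Hardy space of the disk, as a multilinear map into the Hardy space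
of the polydisk. -/
noncomputable def hardyTensor (n : ℕ) :
    MultilinearMap ℂ (fun _ : Fin n => hardyDisk) (hardyPolydisk n) :=
  ((tensorLpMultilinear n).compLinearMap fun _ => hardyDisk.subtype).codRestrict (hardyPolydisk n)
    fun g => tensorLp_mem_hardyPolydisk fun i => (g i).2

theorem coe_hardyTensor (g : Fin n → hardyDisk) :
    (hardyTensor n g : Lp ℂ 2 (torusMeasure n)) = tensorLp fun i => (g i : Lp ℂ 2 haarAddCircle) :=
  rfl

theorem isHilbertTensor_hardyTensor (n : ℕ) : IsHilbertTensor (hardyTensor n) where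
  inner_map x y := inner_tensorLp _ _
  eq_zero_of_inner w hw := by
    have h0 : inner ℂ (w : Lp ℂ 2 (torusMeasure n)) (w : Lp ℂ 2 (torusMeasure n)) = 0 :=
      inner_eq_zero_of_mem_hardyPolydisk
        (fun k hk => hw fun i => ⟨_, fourierLp_mem_hardyDisk (hk i)⟩) w.2
    exact Subtype.ext (inner_self_eq_zero.1 h0)

theorem toeplitzPolydisk_hardyTensor (i : Fin n)
    (f : Lp ℂ ∞ (haarAddCircle : Measure UnitAddCircle)) (x : Fin n → hardyDisk) :
    toeplitzPolydisk (symbolInVariable i f) (hardyTensor n x) =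
      hardyTensor n (Function.update x i (toeplitzDisk f (x i))) := by
  apply Subtype.ext
  change ((hardyPolydisk n).orthogonalProjectionOnto
    ((ContinuousLinearMap.mul ℂ ℂ).holderL (torusMeasure n) ∞ 2 2 (symbolInVariable i f)
      (tensorLp fun j => (x j : Lp ℂ 2 haarAddCircle))) : Lp ℂ 2 (torusMeasure n)) = _
  rw [holder_symbolInVariable, orthogonalProjection_tensorLp, coe_hardyTensor]
  congr 1
  funext j
  by_cases hj : j = i
  · subst hj
    rw [Function.update_self, Function.update_self]
    rfl
  · rw [Function.update_of_ne hj, Function.update_of_ne hj,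
      Submodule.orthogonalProjectionOnto_mem_subspace_eq_self]

theorem toeplitzPolydisk_eq_lift (i : Fin n)
    (f : Lp ℂ ∞ (haarAddCircle : Measure UnitAddCircle)) :
    toeplitzPolydisk (symbolInVariable i f) =
      (isHilbertTensor_hardyTensor n).lift i (toeplitzDisk f) :=
  (isHilbertTensor_hardyTensor n).ext fun x => by
    rw [toeplitzPolydisk_hardyTensor, IsHilbertTensor.lift_apply]

end Concrete

end FredholmTuple

theorem proposition3p1 (n : ℕ) (hn : 1 ≤ n)
    (f : Fin n → Lp ℂ ∞ (haarAddCircle : Measure UnitAddCircle))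
    (hf : ∀ i, ¬ IsUnit (toeplitzDisk (f i))) :
    (IsFredholmTuple (fun i => toeplitzPolydisk (symbolInVariable i (f i))) ↔
        ∀ i, (toeplitzDisk (f i)).IsFredholm) ∧
      (IsFredholmTuple (fun i => toeplitzPolydisk (symbolInVariable i (f i))) →
        tupleIndex (fun i => toeplitzPolydisk (symbolInVariable i (f i))) =
          (-1) ^ (n + 1) * ∏ i, fredholmIndex (toeplitzDisk (f i))) := by
  have hτ := isHilbertTensor_hardyTensor n
  simp only [toeplitzPolydisk_eq_lift]
  have hmp := hτ.isFredholm_of_isFredholmTuple hf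
  exact ⟨⟨hmp, fun h => (hτ.isFredholmTuple_and_index h).1⟩,
    fun h => (hτ.isFredholmTuple_and_index (hmp h)).2⟩
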